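/- Let $a,a^*$ be the annihilation and creation operators of the (unique) irreducible representation of $[a,a^*]=1$ on a complex Hilbert space $\mathcal H$, i.e. $\mathcal H$ has an orthonormal (Hilbert) basis $(e_n)_{n\ge 0}$ with $a e_n=\sqrt n\,e_{n-1}$ and $a^*e_n=\sqrt{n+1}\,e_{n+1}$. For $|z|<1$ let $[\psi(z)]$ be the complex line of solutions of $(a+za^*)\psi=0$ and let $\psi(z)$ be a unit vector in it (a squeezed state). Let $\omega\in\mathbb R$ and $\alpha\in\mathbb C$ with $|\alpha|<\omega$, and $$H_0=\omega a^*a,\qquad H_1=\omega a^*a+\frac{\alpha}{2}a^2+\frac{\bar\alpha}{2}(a^*)^2,\qquad \xi=\frac{\omega-\sqrt{\omega^2-|\alpha|^2}}{\alpha}\quad(\xi=0\text{ if }\alpha=0).$$ For durations $\Delta t_1,\Delta t_2,\ldots\ge 0$ put $S_j=e^{-iH_0\Delta t_j}$ for odd $j$, $S_j=e^{-iH_1\Delta t_j}$ for even $j$, and $U_n=S_n\cdots S_2S_1$. Let $|z_0|<1$, $|z_f|<1$, and define recursively, for $k\ge1$, $$R_{2k+1}=\frac{(1+|\xi|^2)R_{2k-1}+2|\xi|}{2|\xi|R_{2k-1}+(1+|\xi|^2)},\qquad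 R_1=|z_0|,$$ $$r_{2k+1}=\begin{cases}\dfrac{(1+|\xi|^2)r_{2k-1}-2|\xi|}{-2|\xi|r_{2k-1}+(1+|\xi|^2)}&\text{if } r_{2k-1}>\dfrac{2|\xi|}{1+|\xi|^2},\\[2mm]0&\text{otherwise,}\end{cases}\qquad r_1=|z_0|.$$ Then for every $k\ge 0$, there are durations $\Delta t_1,\dots,\Delta t_{2k+1}\ge0$ such that $[\psi(z_f)]=[U_{2k+1}\psi(z_0)]$ (equality of complex lines) if and only if $$r_{2k+1}\le|z_f|\le R_{2k+1}.$$ -/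

import Mathlib

open Complex

noncomputable section

namespace SqueezedStates

variable {ℋ : Type*} [NormedAddCommGroup ℋ] [InnerProductSpace ℂ ℋ]

/-! ## Ladder operators

The irreducible representation of `[a, a*] = 1` is given by its number (Fock) basis: an arbitrary
Hilbert space `ℋ` with a Hilbert basis `e 0, e 1, e 2, …` on which `a (e n) = √n • e (n - 1)` and
`a* (e n) = √(n + 1) • e (n + 1)`. The operators `a`, `a*` are unbounded, with their natural
(maximal) domains. -/

/-- Action of `a` on coordinates: `(a c) n = √(n + 1) * c (n + 1)`. -/
def lowerCoord : (ℕ → ℂ) →ₗ[ℂ] (ℕ → ℂ) where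
  toFun c n := (Real.sqrt (n + 1) : ℂ) * c (n + 1)
  map_add' c d := by ext n; simp [mul_add]
  map_smul' s c := by ext n; simp [mul_left_comm]

/-- Action of `a*` on coordinates: `(a* c) 0 = 0` and `(a* c) (n + 1) = √(n + 1) * c n`. -/
def raiseCoord : (ℕ → ℂ) →ₗ[ℂ] (ℕ → ℂ) where
  toFun c n := (Real.sqrt n : ℂ) * c (n - 1)
  map_add' c d := by ext n; simp [mul_add]
  map_smul' s c := by ext n; simp [mul_left_comm]

/-- The coordinates `n ↦ ⟪e n, ψ⟫` of a vector. -/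
def coords (e : HilbertBasis ℕ ℂ ℋ) : ℋ →ₗ[ℂ] (ℕ → ℂ) where
  toFun ψ n := e.repr ψ n
  map_add' ψ φ := by ext n; simp
  map_smul' s ψ := by ext n; simp

theorem coords_injective (e : HilbertBasis ℕ ℂ ℋ) : Function.Injective (coords e) := by
  intro ψ φ h
  apply e.repr.injective
  ext n
  exact congrFun h n

/-- The vector with given square summable coordinates. -/
def ofCoords (e : HilbertBasis ℕ ℂ ℋ) (c : ℕ → ℂ) (hc : Memℓp c 2) : ℋ :=
  e.repr.symm ⟨c, hc⟩

theorem coords_ofCoords (e : HilbertBasis ℕ ℂ ℋ) (c : ℕ → ℂ) (hc : Memℓp c 2) :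
    coords e (ofCoords e c hc) = c := by
  ext n
  simp [coords, ofCoords]

/-- The operator on `ℋ` acting as `L` on the coordinates in the basis `e`, on the domain of all
vectors whose image is again square summable. -/
def coordOp (e : HilbertBasis ℕ ℂ ℋ) (L : (ℕ → ℂ) →ₗ[ℂ] (ℕ → ℂ)) : ℋ →ₗ.[ℂ] ℋ where
  domain :=
    { carrier := {ψ | Memℓp (L (coords e ψ)) 2}
      add_mem' := fun {ψ φ} (hψ : Memℓp (L (coords e ψ)) 2) (hφ : Memℓp (L (coords e φ)) 2) => by
        change Memℓp (L (coords e (ψ + φ))) 2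
        rw [map_add, map_add]
        exact hψ.add hφ
      zero_mem' := by
        change Memℓp (L (coords e 0)) 2
        rw [map_zero, map_zero]
        exact zero_memℓp
      smul_mem' := fun s ψ (hψ : Memℓp (L (coords e ψ)) 2) => by
        change Memℓp (L (coords e (s • ψ))) 2
        rw [map_smul, map_smul]
        exact hψ.const_smul s }
  toFun :=
    { toFun := fun ψ => ofCoords e (L (coords e ψ)) ψ.2
      map_add' := fun ψ φ => by
        apply coords_injective e
        simp only [map_add, coords_ofCoords, Submodule.coe_add]
      map_smul' := fun s ψ => by
        apply coords_injective e
        simp only [map_smul, coords_ofCoords, Submodule.coe_smul, RingHom.id_apply] }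

/-- The annihilation operator `a`. -/
def annihilation (e : HilbertBasis ℕ ℂ ℋ) : ℋ →ₗ.[ℂ] ℋ := coordOp e lowerCoord

/-- The creation operator `a*`. -/
def creation (e : HilbertBasis ℕ ℂ ℋ) : ℋ →ₗ.[ℂ] ℋ := coordOp e raiseCoord

/-- The product `A B` of two partially defined operators, on its natural domain
`{ψ ∈ D(B) | B ψ ∈ D(A)}`. -/
def opMul (A B : ℋ →ₗ.[ℂ] ℋ) : ℋ →ₗ.[ℂ] ℋ where
  domain := (A.domain.comap B.toFun).map B.domain.subtype
  toFun :=
    { toFun := fun ψ => A ⟨B ⟨ψ, by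
          obtain ⟨y, _, h⟩ := ψ.2
          exact h ▸ y.2⟩, by
        obtain ⟨_, y, hy, rfl⟩ := ψ
        exact hy⟩
      map_add' := fun ψ φ => by
        rw [← LinearPMap.map_add]
        congr 1
        ext
        exact B.map_add ⟨ψ, _⟩ ⟨φ, _⟩
      map_smul' := fun s ψ => by
        rw [RingHom.id_apply, ← LinearPMap.map_smul]
        congr 1
        ext
        exact B.map_smul s ⟨ψ, _⟩ }

/-- The quadratic Hamiltonian `H = ω a* a + (α / 2) a² + (conj α / 2) (a*)²`. As a sum of products
of unbounded operators, its domain is the intersection of the natural domains of the three terms;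
in the stable case `|α| < ω` it is self-adjoint there. -/
def hamiltonian (e : HilbertBasis ℕ ℂ ℋ) (ω : ℝ) (α : ℂ) : ℋ →ₗ.[ℂ] ℋ :=
  (ω : ℂ) • opMul (creation e) (annihilation e)
    + (α / 2) • opMul (annihilation e) (annihilation e)
    + ((starRingEnd ℂ) α / 2) • opMul (creation e) (creation e)

/-- The harmonic oscillator `ω a* a`. -/
def oscillator (e : HilbertBasis ℕ ℂ ℋ) (ω : ℝ) : ℋ →ₗ.[ℂ] ℋ :=
  (ω : ℂ) • opMul (creation e) (annihilation e)

/-! ## Squeezed states -/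

/-- The line `[ψ(z)]` of all solutions of `(a + z a*) ψ = 0`. -/
def squeezedLine (e : HilbertBasis ℕ ℂ ℋ) (z : ℂ) : Submodule ℂ ℋ :=
  (LinearMap.ker (annihilation e + z • creation e).toFun).map
    (annihilation e + z • creation e).domain.subtype

/-- `ψ` is a squeezed state `ψ(z)`: a unit vector in `[ψ(z)]`. -/
def IsSqueezedState (e : HilbertBasis ℕ ℂ ℋ) (z : ℂ) (ψ : ℋ) : Prop :=
  ‖ψ‖ = 1 ∧ ψ ∈ squeezedLine e z

/-! ## Time evolution -/

/-- `Ψ` is a solution of the Schrödinger equation `i Ψ' = H Ψ` (with `Ψ t ∈ D(H)` for all `t`). -/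
def IsSchrodingerSolution (H : ℋ →ₗ.[ℂ] ℋ) (Ψ : ℝ → ℋ) : Prop :=
  ∀ t, ∃ v, HasDerivAt Ψ v t ∧ (Ψ t, I • v) ∈ H.graph

/-- The graph of `exp (-i t H)`: the closure in `ℋ × ℋ` of the solution map `Ψ 0 ↦ Ψ t` of the
Schrödinger equation. For self-adjoint `H` the solution map is isometric with dense domain `D(H)`,
and the closure of its graph is the graph of the unitary operator `exp (-i t H)`. -/
def evolutionGraph (H : ℋ →ₗ.[ℂ] ℋ) (t : ℝ) : Set (ℋ × ℋ) :=
  closure {p | ∃ Ψ : ℝ → ℋ, IsSchrodingerSolution H Ψ ∧ p = (Ψ 0, Ψ t)}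

open scoped Classical in
/-- The time evolution operator `exp (-i t H)` (with the value `0` where it is undefined, which
does not occur for self-adjoint `H`). -/
def evolution (H : ℋ →ₗ.[ℂ] ℋ) (t : ℝ) (ψ : ℋ) : ℋ :=
  if h : ∃ φ, (ψ, φ) ∈ evolutionGraph H t then h.choose else 0

/-! ## Bang-bang control -/

/-- The pulse `S_j`: `exp (-i Δt_j H₀)` for odd `j` and `exp (-i Δt_j H₁)` for even `j`. -/
def pulse (H₀ H₁ : ℋ →ₗ.[ℂ] ℋ) (Δt : ℕ → ℝ) (j : ℕ) : ℋ → ℋ :=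
  if Odd j then evolution H₀ (Δt j) else evolution H₁ (Δt j)

/-- `U_n = S_n ⋯ S_2 S_1`. -/
def pulseProduct (H₀ H₁ : ℋ →ₗ.[ℂ] ℋ) (Δt : ℕ → ℝ) : ℕ → ℋ → ℋ
  | 0 => id
  | n + 1 => pulse H₀ H₁ Δt (n + 1) ∘ pulseProduct H₀ H₁ Δt n

/-- The control problem `[ψ(z_f)] = [U_n ψ(z₀)]` has a solution: there are durations `Δt_j ≥ 0`
such that the vector `U_n ψ(z₀)` spans the line `[ψ(z_f)]`. -/
def Reachable (e : HilbertBasis ℕ ℂ ℋ) (H₀ H₁ : ℋ →ₗ.[ℂ] ℋ) (n : ℕ) (z₀ zf : ℂ) : Prop :=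
  ∃ Δt : ℕ → ℝ, (∀ j, 0 ≤ Δt j) ∧ ∃ ψ₀, IsSqueezedState e z₀ ψ₀ ∧
    squeezedLine e zf = Submodule.span ℂ {pulseProduct H₀ H₁ Δt n ψ₀}

/-! ## The reachable radii -/

/-- The fixed point `ξ = (ω - √(ω² - |α|²)) / α` of the stable Hamiltonian in the open disk. For
`α = 0` the fixed point is `0`, which is the value of the expression in that case. -/
def fixedPoint (ω : ℝ) (α : ℂ) : ℂ :=
  ((ω - Real.sqrt (ω ^ 2 - ‖α‖ ^ 2) : ℝ) : ℂ) / α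

/-- `maxRadius x ρ k` is `R_{2k+1}`, where `x = |ξ|` and `ρ = |z₀|`. -/
def maxRadius (x ρ : ℝ) : ℕ → ℝ
  | 0 => ρ
  | k + 1 => ((1 + x ^ 2) * maxRadius x ρ k + 2 * x) / (2 * x * maxRadius x ρ k + (1 + x ^ 2))

open scoped Classical in
/-- `minRadius x ρ k` is `r_{2k+1}`, where `x = |ξ|` and `ρ = |z₀|`. -/
def minRadius (x ρ : ℝ) : ℕ → ℝ
  | 0 => ρ
  | k + 1 =>
    if 2 * x / (1 + x ^ 2) < minRadius x ρ k then
      ((1 + x ^ 2) * minRadius x ρ k - 2 * x) / (-2 * x * minRadius x ρ k + (1 + x ^ 2))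
    else 0

end SqueezedStates

end

/-!
The proof reduces the control problem to the motion of a point in the unit disk.

**Squeezed vectors.** For `‖z‖ < 1` the equation `(a + z a*) ψ = 0` is a two-step recursion for the
coordinates of `ψ`, so its solutions are the multiples of one vector
`ψ(z) = exp (-z (a*)² / 2) e 0` (`squeezedLine_eq_span`). It is holomorphic in `z` with derivative
`-(a*)² ψ(z) / 2`, while the commutation relation gives
`H ψ(z) = (ᾱ / 2 - ω z + α z² / 2) (a*)² ψ(z) - (α z / 2) ψ(z)`. Hence `c(t) ψ(z(t))` solves the
Schrödinger equation as soon as `z' = i (α z² - 2 ω z + ᾱ)` and `c' = (i α z / 2) c`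
(`exists_squeezed_solution`).

**Well-definedness of the evolution.** Expectation values of `H` are real, so solutions of the
Schrödinger equation have constant norm; the closure of the solution map is therefore an isometric
linear relation and determines its second component from the first (`evolutionGraph_unique`).
Self-adjointness of `H` is not needed, because the solutions that start at squeezed vectors are
explicit.

**The disk.** The Riccati equation is solved by Möbius transformations preserving the unit disk
(`diskFlow`). For `H₀` they are the rotations about the centre, so after an odd number of pulses
only the radius matters. For `H₁` they are the hyperbolic rotations about `ξ`, which move the centre
by at most the hyperbolic distance `artanh (‖α‖ / ω) = 2 artanh ‖ξ‖`. This bounds the change of the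
radius in one pulse (`norm_diskFlow_mul_le`, and `le_norm_diskFlow_mul` by inverting the flow). The
bounds are attained after half a turn about `ξ` on the diameter through `ξ`, and the centre is
reached from every radius up to `‖α‖ / ω`; all radii in between follow from the connectedness of
the annulus (`exists_norm_diskFlow_eq`). Thus annuli go to annuli (`exists_diskPath_eq_iff`).
-/

noncomputable section

namespace SqueezedStates

variable {ℋ : Type*} [NormedAddCommGroup ℋ] [InnerProductSpace ℂ ℋ]

/-! ### Graphs of the operators -/

theorem mem_graph_add_iff (A B : ℋ →ₗ.[ℂ] ℋ) (ψ φ : ℋ) :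
    (ψ, φ) ∈ (A + B).graph ↔
      ∃ u v, (ψ, u) ∈ A.graph ∧ (ψ, v) ∈ B.graph ∧ φ = u + v := by
  simp only [LinearPMap.mem_graph_iff]
  constructor
  · rintro ⟨x, hx, rfl⟩
    have hA : ψ ∈ A.domain := hx ▸ x.2.1
    have hB : ψ ∈ B.domain := hx ▸ x.2.2
    subst hx
    exact ⟨A ⟨x, hA⟩, B ⟨x, hB⟩, ⟨_, rfl, rfl⟩, ⟨_, rfl, rfl⟩, LinearPMap.add_apply A B x⟩
  · rintro ⟨u, v, ⟨x, rfl, rfl⟩, ⟨y, hy, rfl⟩, rfl⟩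
    obtain ⟨y, hy'⟩ := y
    subst hy
    exact ⟨⟨x, x.2, hy'⟩, rfl, LinearPMap.add_apply A B _⟩

theorem mem_graph_smul_iff (s : ℂ) (A : ℋ →ₗ.[ℂ] ℋ) (ψ φ : ℋ) :
    (ψ, φ) ∈ (s • A).graph ↔ ∃ u, (ψ, u) ∈ A.graph ∧ φ = s • u := by
  simp only [LinearPMap.mem_graph_iff]
  constructor
  · rintro ⟨x, rfl, rfl⟩
    exact ⟨_, ⟨x, rfl, rfl⟩, rfl⟩
  · rintro ⟨_, ⟨x, rfl, rfl⟩, rfl⟩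
    exact ⟨x, rfl, rfl⟩

theorem mem_graph_opMul_iff (A B : ℋ →ₗ.[ℂ] ℋ) (ψ φ : ℋ) :
    (ψ, φ) ∈ (opMul A B).graph ↔ ∃ u, (ψ, u) ∈ B.graph ∧ (u, φ) ∈ A.graph := by
  simp only [LinearPMap.mem_graph_iff]
  constructor
  · rintro ⟨⟨_, x, hx, rfl⟩, rfl, rfl⟩
    exact ⟨B x, ⟨x, rfl, rfl⟩, ⟨B x, hx⟩, rfl, rfl⟩
  · rintro ⟨_, ⟨x, rfl, rfl⟩, ⟨y, hy⟩, hyx, rfl⟩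
    change y = B x at hyx
    subst hyx
    exact ⟨⟨x, x, hy, rfl⟩, rfl, rfl⟩

theorem mem_graph_coordOp_iff (e : HilbertBasis ℕ ℂ ℋ) (L : (ℕ → ℂ) →ₗ[ℂ] (ℕ → ℂ)) (ψ φ : ℋ) :
    (ψ, φ) ∈ (coordOp e L).graph ↔ coords e φ = L (coords e ψ) := by
  rw [LinearPMap.mem_graph_iff]
  constructor
  · rintro ⟨x, rfl, rfl⟩
    exact coords_ofCoords e _ x.2
  · intro h
    have hm : Memℓp (L (coords e ψ)) 2 := h ▸ (e.repr φ).2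
    refine ⟨⟨ψ, hm⟩, rfl, coords_injective e ?_⟩
    exact (coords_ofCoords e _ hm).trans h.symm

/-- The domain of `H` consists of the `ψ` for which `u = a ψ` and `v = a* ψ` exist in `ℋ`, and so
do `p = a* u`, `q = a u` and `r = a* v`. -/
theorem mem_graph_hamiltonian_iff (e : HilbertBasis ℕ ℂ ℋ) (ω : ℝ) (α : ℂ) (ψ φ : ℋ) :
    (ψ, φ) ∈ (hamiltonian e ω α).graph ↔ ∃ u v p q r,
      coords e u = lowerCoord (coords e ψ) ∧ coords e v = raiseCoord (coords e ψ) ∧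
      coords e p = raiseCoord (coords e u) ∧ coords e q = lowerCoord (coords e u) ∧
      coords e r = raiseCoord (coords e v) ∧
      φ = (ω : ℂ) • p + (α / 2) • q + ((starRingEnd ℂ) α / 2) • r := by
  simp only [hamiltonian, mem_graph_add_iff, mem_graph_smul_iff, mem_graph_opMul_iff, annihilation,
    creation, mem_graph_coordOp_iff]
  constructor
  · rintro ⟨_, _, ⟨_, _, ⟨p, ⟨u, hu, hp⟩, rfl⟩, ⟨q, ⟨u', hu', hq⟩, rfl⟩, rfl⟩,
      ⟨r, ⟨v, hv, hr⟩, rfl⟩, rfl⟩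
    obtain rfl : u = u' := coords_injective e (hu.trans hu'.symm)
    exact ⟨u, v, p, q, r, hu, hv, hp, hq, hr, rfl⟩
  · rintro ⟨u, v, p, q, r, hu, hv, hp, hq, hr, rfl⟩
    exact ⟨_, _, ⟨_, _, ⟨p, ⟨u, hu, hp⟩, rfl⟩, ⟨q, ⟨u, hu, hq⟩, rfl⟩, rfl⟩,
      ⟨r, ⟨v, hv, hr⟩, rfl⟩, rfl⟩

theorem mem_graph_oscillator_iff (e : HilbertBasis ℕ ℂ ℋ) (ω : ℝ) (ψ φ : ℋ) :
    (ψ, φ) ∈ (oscillator e ω).graph ↔ ∃ u p,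
      coords e u = lowerCoord (coords e ψ) ∧ coords e p = raiseCoord (coords e u) ∧
      φ = (ω : ℂ) • p := by
  simp only [oscillator, mem_graph_smul_iff, mem_graph_opMul_iff, annihilation, creation,
    mem_graph_coordOp_iff]
  constructor
  · rintro ⟨p, ⟨u, hu, hp⟩, rfl⟩
    exact ⟨u, p, hu, hp, rfl⟩
  · rintro ⟨u, p, hu, hp, rfl⟩
    exact ⟨p, ⟨u, hu, hp⟩, rfl⟩

theorem graph_hamiltonian_zero_le_oscillator (e : HilbertBasis ℕ ℂ ℋ) (ω : ℝ) :
    (hamiltonian e ω 0).graph ≤ (oscillator e ω).graph := by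
  rintro ⟨ψ, φ⟩ h
  obtain ⟨u, v, p, q, r, hu, -, hp, -, -, rfl⟩ := (mem_graph_hamiltonian_iff e ω 0 ψ φ).1 h
  exact (mem_graph_oscillator_iff e ω ψ _).2 ⟨u, p, hu, hp, by simp⟩

/-! ### Symmetry of the Hamiltonians -/

/-- `a` and `a*` are formal adjoints of each other. -/
theorem inner_of_lowerCoord_of_raiseCoord (e : HilbertBasis ℕ ℂ ℋ) {ψ φ u v : ℋ}
    (hu : coords e u = lowerCoord (coords e ψ)) (hv : coords e v = raiseCoord (coords e φ)) :
    inner ℂ u φ = inner ℂ ψ v := by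
  have h1 : HasSum (fun n => inner ℂ (e.repr u n) (e.repr φ n)) (inner ℂ u φ) := by
    rw [← e.repr.inner_map_map u φ]
    exact lp.hasSum_inner _ _
  have h2 : HasSum (fun n => inner ℂ (e.repr ψ n) (e.repr v n)) (inner ℂ ψ v) := by
    rw [← e.repr.inner_map_map ψ v]
    exact lp.hasSum_inner _ _
  have hu' : ∀ n, e.repr u n = (Real.sqrt (n + 1) : ℂ) * e.repr ψ (n + 1) := congrFun hu
  have hv' : ∀ n, e.repr v n = (Real.sqrt n : ℂ) * e.repr φ (n - 1) := congrFun hv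
  rw [← hasSum_nat_add_iff' 1] at h2
  simp only [Finset.range_one, Finset.sum_singleton, hv' 0, Nat.cast_zero, Real.sqrt_zero,
    ofReal_zero, zero_mul, inner_zero_right, sub_zero] at h2
  refine h1.unique (h2.congr_fun fun n => ?_)
  simp only [hu' n, hv' (n + 1), RCLike.inner_apply, map_mul, conj_ofReal, Nat.cast_add,
    Nat.cast_one, Nat.add_sub_cancel]
  ring

/-- An operator all of whose expectation values are real; every symmetric operator is one. -/
def HasRealExpectation (H : ℋ →ₗ.[ℂ] ℋ) : Prop :=
  ∀ ψ φ, (ψ, φ) ∈ H.graph → (inner ℂ ψ φ).im = 0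

theorem hasRealExpectation_oscillator (e : HilbertBasis ℕ ℂ ℋ) (ω : ℝ) :
    HasRealExpectation (oscillator e ω) := by
  intro ψ φ h
  obtain ⟨u, p, hu, hp, rfl⟩ := (mem_graph_oscillator_iff e ω ψ φ).1 h
  rw [inner_smul_right, ← inner_of_lowerCoord_of_raiseCoord e hu hp, inner_self_eq_norm_sq_to_K,
    ← conj_eq_iff_im]
  simp only [map_mul, map_pow, conj_ofReal, coe_algebraMap]

theorem hasRealExpectation_hamiltonian (e : HilbertBasis ℕ ℂ ℋ) (ω : ℝ) (α : ℂ) :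
    HasRealExpectation (hamiltonian e ω α) := by
  intro ψ φ h
  obtain ⟨u, v, p, q, r, hu, hv, hp, hq, hr, rfl⟩ := (mem_graph_hamiltonian_iff e ω α ψ φ).1 h
  have hq' : inner ℂ ψ q = starRingEnd ℂ (inner ℂ u v) := by
    rw [← inner_conj_symm, inner_of_lowerCoord_of_raiseCoord e hq hv]
  rw [inner_add_right, inner_add_right, inner_smul_right, inner_smul_right, inner_smul_right,
    ← inner_of_lowerCoord_of_raiseCoord e hu hp, hq', ← inner_of_lowerCoord_of_raiseCoord e hu hr,
    inner_self_eq_norm_sq_to_K]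
  rw [← conj_eq_iff_im]
  simp only [map_add, map_mul, map_div₀, conj_conj, conj_ofReal, coe_algebraMap, map_pow,
    map_ofNat]
  ring

/-! ### The time evolution is well defined -/

theorem IsSchrodingerSolution.norm_eq {H : ℋ →ₗ.[ℂ] ℋ} (hH : HasRealExpectation H) {Ψ : ℝ → ℋ}
    (hΨ : IsSchrodingerSolution H Ψ) (t : ℝ) : ‖Ψ t‖ = ‖Ψ 0‖ := by
  have key : ∀ s, HasDerivAt (fun s => ‖Ψ s‖ ^ 2) 0 s := by
    intro s
    obtain ⟨v, hv, hg⟩ := hΨ s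
    have him := hH _ _ hg
    rw [inner_smul_right] at him
    let _ : InnerProductSpace ℝ ℋ := InnerProductSpace.rclikeToReal ℂ ℋ
    have h := hv.norm_sq
    have h0 : inner ℝ (Ψ s) v = 0 := by
      rw [real_inner_eq_re_inner ℂ]
      simpa using him
    rwa [h0, mul_zero] at h
  have hc := is_const_of_deriv_eq_zero (fun s => (key s).differentiableAt)
    (fun s => (key s).deriv) t 0
  exact (sq_eq_sq₀ (norm_nonneg _) (norm_nonneg _)).1 hc

/-- The solution map `Ψ 0 ↦ Ψ t` as a linear relation. -/
def solutionRelation (H : ℋ →ₗ.[ℂ] ℋ) (t : ℝ) : Submodule ℂ (ℋ × ℋ) where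
  carrier := {p | ∃ Ψ : ℝ → ℋ, IsSchrodingerSolution H Ψ ∧ p = (Ψ 0, Ψ t)}
  zero_mem' := ⟨fun _ => 0, fun s => ⟨0, hasDerivAt_const s 0, by
    rw [smul_zero]; exact H.graph.zero_mem⟩, rfl⟩
  add_mem' := by
    rintro _ _ ⟨Ψ, hΨ, rfl⟩ ⟨Φ, hΦ, rfl⟩
    refine ⟨fun s => Ψ s + Φ s, fun s => ?_, rfl⟩
    obtain ⟨v, hv, hv'⟩ := hΨ s
    obtain ⟨w, hw, hw'⟩ := hΦ s
    exact ⟨v + w, hv.add hw, by rw [smul_add]; exact H.graph.add_mem hv' hw'⟩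
  smul_mem' := by
    rintro c _ ⟨Ψ, hΨ, rfl⟩
    refine ⟨fun s => c • Ψ s, fun s => ?_, rfl⟩
    obtain ⟨v, hv, hv'⟩ := hΨ s
    exact ⟨c • v, hv.const_smul c, by rw [smul_comm]; exact H.graph.smul_mem c hv'⟩

theorem norm_snd_eq_of_mem_evolutionGraph {H : ℋ →ₗ.[ℂ] ℋ} (hH : HasRealExpectation H) {t : ℝ}
    {p : ℋ × ℋ} (hp : p ∈ evolutionGraph H t) : ‖p.2‖ = ‖p.1‖ := by
  have hcl : IsClosed {p : ℋ × ℋ | ‖p.2‖ = ‖p.1‖} :=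
    isClosed_eq continuous_snd.norm continuous_fst.norm
  refine closure_minimal ?_ hcl hp
  rintro _ ⟨Ψ, hΨ, rfl⟩
  exact hΨ.norm_eq hH t

/-- An initial value has at most one image under the time evolution, because the closure of the
solution relation is an isometric linear relation. -/
theorem evolutionGraph_unique {H : ℋ →ₗ.[ℂ] ℋ} (hH : HasRealExpectation H) {t : ℝ}
    {ψ φ₁ φ₂ : ℋ} (h₁ : (ψ, φ₁) ∈ evolutionGraph H t) (h₂ : (ψ, φ₂) ∈ evolutionGraph H t) :
    φ₁ = φ₂ := by
  have h : (ψ, φ₁) - (ψ, φ₂) ∈ (solutionRelation H t).topologicalClosure :=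
    Submodule.sub_mem _ h₁ h₂
  have h' := norm_snd_eq_of_mem_evolutionGraph hH (p := (ψ, φ₁) - (ψ, φ₂)) h
  simpa [sub_eq_zero] using h'

theorem IsSchrodingerSolution.evolution_eq {H : ℋ →ₗ.[ℂ] ℋ} (hH : HasRealExpectation H)
    {Ψ : ℝ → ℋ} (hΨ : IsSchrodingerSolution H Ψ) (t : ℝ) : evolution H t (Ψ 0) = Ψ t := by
  have h : (Ψ 0, Ψ t) ∈ evolutionGraph H t := subset_closure ⟨Ψ, hΨ, rfl⟩
  have hex : ∃ φ, (Ψ 0, φ) ∈ evolutionGraph H t := ⟨_, h⟩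
  rw [evolution, dif_pos hex]
  exact evolutionGraph_unique hH hex.choose_spec h

/-! ### Rapidly decreasing coordinates -/

/-- The sequence `c` is rapidly decreasing: it is summable against every polynomial weight. -/
def RapidDecay (c : ℕ → ℂ) : Prop :=
  ∀ j : ℕ, Summable fun n : ℕ => ((n : ℝ) + 1) ^ j * ‖c n‖

theorem RapidDecay.memℓp {c : ℕ → ℂ} (hc : RapidDecay c) : Memℓp c 2 := by
  have h1 : Memℓp c 1 := memℓp_gen (by simpa using hc 0)
  exact h1.of_exponent_ge (by norm_num)

theorem RapidDecay.lowerCoord {c : ℕ → ℂ} (hc : RapidDecay c) : RapidDecay (lowerCoord c) := by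
  intro j
  refine Summable.of_nonneg_of_le (fun n => by positivity) (fun n => ?_)
    ((summable_nat_add_iff 1).2 (hc (j + 1)))
  have h1 : Real.sqrt ((n : ℝ) + 1) ≤ n + 1 + 1 :=
    (Real.sqrt_le_left (by positivity)).2 (by nlinarith [(Nat.cast_nonneg n : (0 : ℝ) ≤ n)])
  have h2 : ‖SqueezedStates.lowerCoord c n‖ = Real.sqrt (n + 1) * ‖c (n + 1)‖ := by
    simp [SqueezedStates.lowerCoord, abs_of_nonneg (Real.sqrt_nonneg _)]
  rw [h2, pow_succ, ← mul_assoc]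
  push_cast
  gcongr
  linarith

theorem RapidDecay.raiseCoord {c : ℕ → ℂ} (hc : RapidDecay c) : RapidDecay (raiseCoord c) := by
  intro j
  rw [← summable_nat_add_iff 1]
  refine Summable.of_nonneg_of_le (fun n => by positivity) (fun n => ?_)
    ((hc (j + 1)).mul_left (2 ^ j))
  have h1 : Real.sqrt ((n : ℝ) + 1) ≤ n + 1 :=
    (Real.sqrt_le_left (by positivity)).2 (by nlinarith [(Nat.cast_nonneg n : (0 : ℝ) ≤ n)])
  have h2 : ‖SqueezedStates.raiseCoord c (n + 1)‖ = Real.sqrt (n + 1) * ‖c n‖ := by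
    simp [SqueezedStates.raiseCoord, abs_of_nonneg (Real.sqrt_nonneg _)]
  rw [h2, pow_succ, ← mul_assoc, ← mul_assoc, ← mul_assoc, ← mul_pow]
  push_cast
  gcongr
  linarith [(Nat.cast_nonneg n : (0 : ℝ) ≤ n)]

theorem summable_pow_mul_pow_half (j : ℕ) {x : ℝ} (hx0 : 0 ≤ x) (hx1 : x < 1) :
    Summable fun n : ℕ => ((n : ℝ) + 1) ^ j * x ^ (n / 2) := by
  -- `x ≤ r²` with `1/2 ≤ r < 1`, so that `x ^ (n / 2)` is at most `4 r ^ (n + 1)`.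
  set y : ℝ := max x (1 / 4) with hy
  have hy1 : y < 1 := max_lt hx1 (by norm_num)
  have hy4 : 1 / 4 ≤ y := le_max_right _ _
  set r : ℝ := Real.sqrt y with hr
  have hr2 : r ^ 2 = y := Real.sq_sqrt (by linarith)
  have hr0 : 0 ≤ r := Real.sqrt_nonneg _
  have hr1 : r < 1 := by nlinarith
  have hs := (summable_nat_add_iff 1).2
    (summable_pow_mul_geometric_of_norm_lt_one j (r := r) (by rwa [Real.norm_of_nonneg hr0]))
  refine Summable.of_nonneg_of_le (fun n => by positivity) (fun n => ?_) (hs.mul_left 4)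
  have h1 : x ^ (n / 2) ≤ y ^ (n / 2) := by gcongr; exact le_max_left _ _
  have h2 : y * y ^ (n / 2) ≤ r ^ (n + 1) := by
    rw [← pow_succ', ← hr2, ← pow_mul]
    exact pow_le_pow_of_le_one hr0 hr1.le (by omega)
  have h3 : x ^ (n / 2) ≤ 4 * r ^ (n + 1) := by
    nlinarith [pow_nonneg (by linarith : (0 : ℝ) ≤ y) (n / 2)]
  push_cast
  calc ((n : ℝ) + 1) ^ j * x ^ (n / 2) ≤ ((n : ℝ) + 1) ^ j * (4 * r ^ (n + 1)) := by gcongr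
    _ = 4 * (((n : ℝ) + 1) ^ j * r ^ (n + 1)) := by ring

/-! ### Squeezed vectors -/

/-- The numbers `β n` with `β (2 m) = √((2m choose m) / 4 ^ m)` and `β (2 m + 1) = 0`, defined by
the recursion that makes `∑ β n (-z) ^ (n / 2) e n` a solution of `(a + z a*) ψ = 0`. -/
def squeezedWeight : ℕ → ℝ
  | 0 => 1
  | 1 => 0
  | n + 2 => Real.sqrt (n + 1) / Real.sqrt (n + 2) * squeezedWeight n

theorem squeezedWeight_mem_Icc (n : ℕ) : 0 ≤ squeezedWeight n ∧ squeezedWeight n ≤ 1 := by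
  induction n using Nat.twoStepInduction with
  | zero => simp [squeezedWeight]
  | one => simp [squeezedWeight]
  | more n ih _ =>
    have h : Real.sqrt ((n : ℝ) + 1) / Real.sqrt (n + 2) ≤ 1 :=
      div_le_one_of_le₀ (Real.sqrt_le_sqrt (by linarith)) (Real.sqrt_nonneg _)
    exact ⟨mul_nonneg (by positivity) ih.1, mul_le_one₀ h ih.1 ih.2⟩

theorem squeezedWeight_odd (m : ℕ) : squeezedWeight (2 * m + 1) = 0 := by
  induction m with
  | zero => rfl
  | succ m ih =>
    change _ * squeezedWeight (2 * m + 1) = 0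
    rw [ih, mul_zero]

theorem sqrt_mul_sqrt_mul_squeezedWeight (n : ℕ) :
    Real.sqrt (n + 2) * (Real.sqrt (n + 1) * squeezedWeight n) =
      (n + 2) * squeezedWeight (n + 2) := by
  have h : Real.sqrt ((n : ℝ) + 2) ≠ 0 := by positivity
  have h2 : ((n : ℝ) + 2) = Real.sqrt (n + 2) * Real.sqrt (n + 2) :=
    (Real.mul_self_sqrt (by positivity)).symm
  rw [squeezedWeight]
  nth_rewrite 2 [h2]
  field_simp

/-- The coordinates of the solution of `(a + z a*) ψ = 0` with `⟪e 0, ψ⟫ = 1`. -/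
def squeezedCoord (z : ℂ) (n : ℕ) : ℂ := squeezedWeight n * (-z) ^ (n / 2)

/-- The derivative of `squeezedCoord z n` with respect to `z`. -/
def squeezedCoordDeriv (z : ℂ) (n : ℕ) : ℂ :=
  -((n : ℂ) / 2) * (squeezedWeight n * (-z) ^ (n / 2 - 1))

theorem norm_squeezedCoord_le (z : ℂ) (n : ℕ) : ‖squeezedCoord z n‖ ≤ ‖z‖ ^ (n / 2) := by
  rw [squeezedCoord, norm_mul, norm_pow, norm_neg, norm_real,
    Real.norm_of_nonneg (squeezedWeight_mem_Icc n).1]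
  exact mul_le_of_le_one_left (by positivity) (squeezedWeight_mem_Icc n).2

theorem rapidDecay_squeezedCoord {z : ℂ} (hz : ‖z‖ < 1) : RapidDecay (squeezedCoord z) := by
  intro j
  refine Summable.of_nonneg_of_le (fun n => by positivity) (fun n => ?_)
    (summable_pow_mul_pow_half j (norm_nonneg z) hz)
  gcongr
  exact norm_squeezedCoord_le z n

theorem hasDerivAt_squeezedCoord (n : ℕ) (z : ℂ) :
    HasDerivAt (fun z => squeezedCoord z n) (squeezedCoordDeriv z n) z := by
  have h := ((hasDerivAt_neg z).pow (n / 2)).const_mul (squeezedWeight n : ℂ)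
  refine h.congr_deriv ?_
  rw [squeezedCoordDeriv]
  obtain ⟨m, rfl | rfl⟩ := n.even_or_odd'
  · have : 2 * m / 2 = m := by omega
    rw [this]
    push_cast
    ring
  · simp [squeezedWeight_odd]

/-- In terms of `ψ(z) = exp (-z (a*)² / 2) e 0`: the derivative is `-(a*)² / 2` applied to `ψ(z)`. -/
theorem squeezedCoordDeriv_eq (z : ℂ) :
    squeezedCoordDeriv z = (-(1 / 2) : ℂ) • raiseCoord (raiseCoord (squeezedCoord z)) := by
  ext n
  match n with
  | 0 => simp [squeezedCoordDeriv, raiseCoord]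
  | 1 => simp [squeezedCoordDeriv, raiseCoord, squeezedWeight]
  | n + 2 =>
    have h := congrArg (fun x : ℝ => (x : ℂ)) (sqrt_mul_sqrt_mul_squeezedWeight n)
    have h2 : (n + 2) / 2 - 1 = n / 2 := by omega
    have h3 : ((n + 2 : ℕ) : ℝ) = n + 2 := by push_cast; rfl
    have h4 : ((n + 1 : ℕ) : ℝ) = n + 1 := by push_cast; rfl
    simp only [squeezedCoordDeriv, raiseCoord, squeezedCoord, LinearMap.coe_mk, AddHom.coe_mk,
      Pi.smul_apply, smul_eq_mul, h2, h3, Nat.add_succ_sub_one, h4]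
    push_cast at h ⊢
    linear_combination (1 / 2) * (-z) ^ (n / 2) * h

theorem lowerCoord_squeezedCoord (z : ℂ) :
    lowerCoord (squeezedCoord z) = (-z) • raiseCoord (squeezedCoord z) := by
  ext n
  match n with
  | 0 => simp [lowerCoord, raiseCoord, squeezedCoord, squeezedWeight]
  | n + 1 =>
    have h1 : (n + 2) / 2 = n / 2 + 1 := by omega
    have h2 : (n : ℝ) + 1 + 1 = n + 2 := by ring
    have h3 : ((n + 1 : ℕ) : ℝ) = n + 1 := by push_cast; rfl
    have h : (Real.sqrt ((n : ℝ) + 2) : ℂ) ≠ 0 := by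
      rw [Ne, ofReal_eq_zero]
      positivity
    simp only [lowerCoord, raiseCoord, squeezedCoord, LinearMap.coe_mk, AddHom.coe_mk,
      Pi.smul_apply, smul_eq_mul, squeezedWeight, h1, Nat.add_succ_sub_one, h3, h2, add_zero]
    push_cast
    field_simp
    ring

/-- A sequence `c` with `(a + z a*) c = 0` is determined by `c 0`. -/
theorem eq_smul_squeezedCoord {z : ℂ} {c : ℕ → ℂ}
    (hc : lowerCoord c + z • raiseCoord c = 0) : c = c 0 • squeezedCoord z := by
  have key : ∀ (n : ℕ) (d : ℕ → ℂ), lowerCoord d + z • raiseCoord d = 0 → d 0 = 0 → d n = 0 := by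
    intro n d hd hd0
    induction n using Nat.twoStepInduction with
    | zero => exact hd0
    | one => simpa [lowerCoord, raiseCoord] using congrFun hd 0
    | more n ih _ =>
      have h := congrFun hd (n + 1)
      have hne : (Real.sqrt (((n + 1 : ℕ) : ℝ) + 1) : ℂ) ≠ 0 := by
        rw [Ne, ofReal_eq_zero]
        positivity
      simp only [lowerCoord, raiseCoord, LinearMap.coe_mk, AddHom.coe_mk, Pi.add_apply,
        Pi.smul_apply, Nat.add_succ_sub_one, add_zero, ih, mul_zero, smul_zero, Pi.zero_apply] at h
      exact (mul_eq_zero.1 h).resolve_left hne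
  ext n
  rw [← sub_eq_zero]
  refine key n (c - c 0 • squeezedCoord z) ?_ (by simp [squeezedCoord, squeezedWeight])
  rw [map_sub, map_sub, map_smul, map_smul, lowerCoord_squeezedCoord, smul_sub, ← sub_eq_zero.2 hc]
  module

/-- The squeezed vector `∑ squeezedCoord z n • e n`, not normalized. For `1 ≤ ‖z‖` the sum
diverges and the value is meaningless. -/
def squeezedVec (e : HilbertBasis ℕ ℂ ℋ) (z : ℂ) : ℋ := ∑' n, squeezedCoord z n • e n

theorem coords_tsum_smul (e : HilbertBasis ℕ ℂ ℋ) {c : ℕ → ℂ} (hc : Memℓp c 2) :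
    coords e (∑' n, c n • e n) = c := by
  have h : (∑' n, c n • e n) = ofCoords e c hc := (e.hasSum_repr_symm ⟨c, hc⟩).tsum_eq
  rw [h, coords_ofCoords]

theorem coords_squeezedVec (e : HilbertBasis ℕ ℂ ℋ) {z : ℂ} (hz : ‖z‖ < 1) :
    coords e (squeezedVec e z) = squeezedCoord z :=
  coords_tsum_smul e (rapidDecay_squeezedCoord hz).memℓp

theorem hasDerivAt_squeezedVec [CompleteSpace ℋ] (e : HilbertBasis ℕ ℂ ℋ) {z : ℂ} (hz : ‖z‖ < 1) :
    HasDerivAt (squeezedVec e) (∑' n, squeezedCoordDeriv z n • e n) z := by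
  obtain ⟨ρ, hzρ, hρ⟩ := exists_between hz
  have hρ0 : 0 ≤ ρ := (norm_nonneg z).trans hzρ.le
  have he : ∀ n, ‖e n‖ = 1 := e.orthonormal.1
  have hu : Summable fun n : ℕ => ((n : ℝ) + 1) ^ 1 * ρ ^ (n / 2 - 1) := by
    rw [← summable_nat_add_iff 2]
    refine Summable.of_nonneg_of_le (fun n => by positivity) (fun n => ?_)
      ((summable_pow_mul_pow_half 1 hρ0 hρ).mul_left 3)
    have h2 : (n + 2) / 2 - 1 = n / 2 := by omega
    rw [h2, ← mul_assoc]
    push_cast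
    gcongr
    linarith [(Nat.cast_nonneg n : (0 : ℝ) ≤ n)]
  refine hasDerivAt_tsum_of_isPreconnected (t := Metric.ball 0 ρ) (y₀ := z) hu Metric.isOpen_ball
    (convex_ball 0 ρ).isPreconnected
    (fun n y _ => (hasDerivAt_squeezedCoord n y).smul_const (e n)) (fun n y hy => ?_)
    (by simpa using hzρ) ?_ (by simpa using hzρ)
  · have hy' : ‖y‖ ≤ ρ := by simpa using (Metric.mem_ball.1 hy).le
    have hw := squeezedWeight_mem_Icc n
    rw [norm_smul, he, mul_one, squeezedCoordDeriv, norm_mul, norm_neg, norm_mul, norm_pow,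
      norm_neg, norm_real, Real.norm_of_nonneg hw.1, norm_div, norm_natCast, pow_one]
    refine mul_le_mul ?_ ?_ (mul_nonneg hw.1 (by positivity)) (by positivity)
    · rw [Complex.norm_ofNat]
      linarith [(Nat.cast_nonneg n : (0 : ℝ) ≤ n)]
    · calc squeezedWeight n * ‖y‖ ^ (n / 2 - 1) ≤ 1 * ‖y‖ ^ (n / 2 - 1) := by
            gcongr
            exact hw.2
        _ ≤ ρ ^ (n / 2 - 1) := by rw [one_mul]; gcongr
  · refine Summable.of_norm ?_
    simpa [norm_smul, he] using rapidDecay_squeezedCoord hz 0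

theorem mem_squeezedLine_iff (e : HilbertBasis ℕ ℂ ℋ) (z : ℂ) (ψ : ℋ) :
    ψ ∈ squeezedLine e z ↔ ∃ u v, coords e u = lowerCoord (coords e ψ) ∧
      coords e v = raiseCoord (coords e ψ) ∧ u + z • v = 0 := by
  have h : ψ ∈ squeezedLine e z ↔ (ψ, 0) ∈ (annihilation e + z • creation e).graph := by
    rw [LinearPMap.mem_graph_iff]
    constructor
    · rintro ⟨x, hx, rfl⟩
      exact ⟨x, rfl, hx⟩
    · rintro ⟨x, rfl, hx⟩
      exact ⟨x, hx, rfl⟩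
  rw [h, mem_graph_add_iff]
  simp only [mem_graph_smul_iff, annihilation, creation, mem_graph_coordOp_iff]
  constructor
  · rintro ⟨u, _, hu, ⟨v, hv, rfl⟩, h⟩
    exact ⟨u, v, hu, hv, h.symm⟩
  · rintro ⟨u, v, hu, hv, h⟩
    exact ⟨u, z • v, hu, ⟨v, hv, rfl⟩, h.symm⟩

theorem squeezedLine_eq_span (e : HilbertBasis ℕ ℂ ℋ) {z : ℂ} (hz : ‖z‖ < 1) :
    squeezedLine e z = Submodule.span ℂ {squeezedVec e z} := by
  have hd := rapidDecay_squeezedCoord hz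
  apply le_antisymm
  · intro ψ hψ
    obtain ⟨u, v, hu, hv, h⟩ := (mem_squeezedLine_iff e z ψ).1 hψ
    have h' : lowerCoord (coords e ψ) + z • raiseCoord (coords e ψ) = 0 := by
      rw [← hu, ← hv, ← map_smul, ← map_add, h, map_zero]
    refine Submodule.mem_span_singleton.2 ⟨coords e ψ 0, coords_injective e ?_⟩
    rw [map_smul, coords_squeezedVec e hz]
    exact (eq_smul_squeezedCoord h').symm
  · rw [Submodule.span_singleton_le_iff_mem, mem_squeezedLine_iff, coords_squeezedVec e hz]
    refine ⟨_, _, coords_tsum_smul e hd.lowerCoord.memℓp, coords_tsum_smul e hd.raiseCoord.memℓp,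
      coords_injective e ?_⟩
    rw [map_add, map_smul, map_zero, coords_tsum_smul e hd.lowerCoord.memℓp,
      coords_tsum_smul e hd.raiseCoord.memℓp, lowerCoord_squeezedCoord]
    module

theorem coords_squeezedVec_zero (e : HilbertBasis ℕ ℂ ℋ) {z : ℂ} (hz : ‖z‖ < 1) :
    coords e (squeezedVec e z) 0 = 1 := by
  simp [coords_squeezedVec e hz, squeezedCoord, squeezedWeight]

theorem squeezedVec_ne_zero (e : HilbertBasis ℕ ℂ ℋ) {z : ℂ} (hz : ‖z‖ < 1) :
    squeezedVec e z ≠ 0 := by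
  intro h
  have := coords_squeezedVec_zero e hz
  simp [h] at this

theorem eq_of_squeezedLine_eq (e : HilbertBasis ℕ ℂ ℋ) {z w : ℂ} (hz : ‖z‖ < 1) (hw : ‖w‖ < 1)
    (h : squeezedLine e z = squeezedLine e w) : z = w := by
  rw [squeezedLine_eq_span e hz, squeezedLine_eq_span e hw] at h
  obtain ⟨s, hs⟩ := Submodule.mem_span_singleton.1
    (h ▸ Submodule.mem_span_singleton_self (squeezedVec e z))
  have h0 := congrFun (congrArg (coords e) hs) 0
  have h2 := congrFun (congrArg (coords e) hs) 2
  simp only [map_smul, coords_squeezedVec e hz, coords_squeezedVec e hw, Pi.smul_apply,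
    squeezedCoord, squeezedWeight] at h0 h2
  simp at h0 h2
  rw [h0] at h2
  simpa using h2.symm

theorem exists_isSqueezedState (e : HilbertBasis ℕ ℂ ℋ) {z : ℂ} (hz : ‖z‖ < 1) :
    ∃ ψ, IsSqueezedState e z ψ := by
  refine ⟨((‖squeezedVec e z‖⁻¹ : ℝ) : ℂ) • squeezedVec e z, ?_, ?_⟩
  · rw [norm_smul, norm_real, norm_inv, norm_norm]
    exact inv_mul_cancel₀ (norm_ne_zero_iff.2 (squeezedVec_ne_zero e hz))
  · rw [squeezedLine_eq_span e hz]
    exact Submodule.smul_mem _ _ (Submodule.mem_span_singleton_self _)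

/-! ### Squeezed solutions of the Schrödinger equation -/

/-- The canonical commutation relation `a a* = a* a + 1` on coordinates. -/
theorem lowerCoord_raiseCoord (c : ℕ → ℂ) :
    lowerCoord (raiseCoord c) = raiseCoord (lowerCoord c) + c := by
  ext n
  have h : ∀ x : ℝ, 0 ≤ x → (Real.sqrt x : ℂ) * (Real.sqrt x : ℂ) = x := fun x hx => by
    rw [← ofReal_mul, Real.mul_self_sqrt hx]
  match n with
  | 0 => simp [lowerCoord, raiseCoord]
  | n + 1 =>
    have h1 := h ((n : ℝ) + 1) (by positivity)
    have h2 := h ((n : ℝ) + 1 + 1) (by positivity)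
    simp only [lowerCoord, raiseCoord, LinearMap.coe_mk, AddHom.coe_mk, Pi.add_apply,
      Nat.add_succ_sub_one, add_zero, Nat.cast_add, Nat.cast_one]
    push_cast at h1 h2
    linear_combination c (n + 1) * h2 - c (n + 1) * h1

/-- `H ψ = (ᾱ / 2 - ω z + α z² / 2) (a*)² ψ - (α z / 2) ψ` for `ψ = ψ(z)`. -/
theorem squeezedVec_mem_graph_hamiltonian (e : HilbertBasis ℕ ℂ ℋ) (ω : ℝ) (α : ℂ) {z : ℂ}
    (hz : ‖z‖ < 1) :
    (squeezedVec e z,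
      (-(2 * ((starRingEnd ℂ) α / 2 - ω * z + α * z ^ 2 / 2))) •
        (∑' n, squeezedCoordDeriv z n • e n) - (α * z / 2) • squeezedVec e z) ∈
      (hamiltonian e ω α).graph := by
  have hd := rapidDecay_squeezedCoord hz
  have hc := coords_squeezedVec e hz
  have hR := coords_tsum_smul e hd.raiseCoord.memℓp
  have hRR := coords_tsum_smul e hd.raiseCoord.raiseCoord.memℓp
  have hD : coords e (∑' n, squeezedCoordDeriv z n • e n) =
      (-(1 / 2) : ℂ) • raiseCoord (raiseCoord (squeezedCoord z)) := by
    rw [coords_tsum_smul e, squeezedCoordDeriv_eq]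
    rw [squeezedCoordDeriv_eq]
    exact hd.raiseCoord.raiseCoord.memℓp.const_smul _
  set v := ∑' n, raiseCoord (squeezedCoord z) n • e n
  set r := ∑' n, raiseCoord (raiseCoord (squeezedCoord z)) n • e n
  refine (mem_graph_hamiltonian_iff e ω α _ _).2
    ⟨(-z) • v, v, (-z) • r, (-z) • ((-z) • r + squeezedVec e z), r, ?_, ?_, ?_, ?_, ?_, ?_⟩
  · rw [map_smul, hR, hc, lowerCoord_squeezedCoord]
  · rw [hR, hc]
  · rw [map_smul, map_smul, map_smul, hR, hRR]
  · rw [map_smul, map_smul, map_smul, map_add, map_smul, hRR, hR, hc, lowerCoord_raiseCoord,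
      lowerCoord_squeezedCoord, map_smul]
  · rw [hRR, hR]
  · apply coords_injective e
    simp only [map_add, map_sub, map_smul, hRR, hc, hD]
    module

/-- A solution `z` of the Riccati equation `z' = i (α z² - 2 ω z + ᾱ)` in the unit disk carries a
squeezed solution of the Schrödinger equation; the phase and the normalization are absorbed in
the factor `exp (∫ i α z / 2)`. -/
theorem exists_squeezed_solution [CompleteSpace ℋ] (e : HilbertBasis ℕ ℂ ℋ) (ω : ℝ) (α : ℂ)
    {z : ℝ → ℂ} (hz : ∀ t, ‖z t‖ < 1)
    (hz' : ∀ t, HasDerivAt z (I * (α * z t ^ 2 - 2 * ω * z t + (starRingEnd ℂ) α)) t) :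
    ∃ c : ℝ → ℂ, (∀ t, c t ≠ 0) ∧ c 0 = 1 ∧
      IsSchrodingerSolution (hamiltonian e ω α) fun t => c t • squeezedVec e (z t) := by
  have hcont : Continuous fun t => I * α / 2 * z t :=
    continuous_const.mul (continuous_iff_continuousAt.2 fun t => (hz' t).continuousAt)
  refine ⟨fun t => exp (∫ s in (0 : ℝ)..t, I * α / 2 * z s), fun t => exp_ne_zero _, by simp,
    fun t => ?_⟩
  have h1 := (hcont.integral_hasStrictDerivAt 0 t).hasDerivAt.cexp
  have h2 := (hasDerivAt_squeezedVec e (hz t)).scomp t (hz' t)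
  refine ⟨_, h1.smul h2, ?_⟩
  have h3 := (hamiltonian e ω α).graph.smul_mem (exp (∫ s in (0 : ℝ)..t, I * α / 2 * z s))
    (squeezedVec_mem_graph_hamiltonian e ω α (hz t))
  convert h3 using 1
  rw [Prod.smul_mk, Prod.mk.injEq]
  refine ⟨rfl, ?_⟩
  set D := ∑' n, squeezedCoordDeriv (z t) n • e n
  set E := exp (∫ s in (0 : ℝ)..t, I * α / 2 * z s)
  simp only [smul_add, smul_sub, smul_smul, ← mul_assoc]
  rw [show I * E * I = -E by linear_combination E * I_mul_I,
    show I * E * (I * α / 2) * z t = -(E * α * z t / 2) by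
      linear_combination E * α * z t / 2 * I_mul_I]
  module

/-! ### The flow of the Riccati equation on the unit disk -/

/-- The frequency `√(ω² - |α|²)` of the stable Hamiltonian. -/
def gap (ω : ℝ) (α : ℂ) : ℝ := Real.sqrt (ω ^ 2 - ‖α‖ ^ 2)

/-- First homogeneous coordinate of the Riccati flow: the matrix
`X = [[-i ω, i ᾱ], [-i α, i ω]]` has `X² = -gap²`, hence
`exp (t X) = cos (gap t) + (sin (gap t) / gap) X`, which is applied here to `(z, 1)`. -/
def flowNum (ω : ℝ) (α : ℂ) (t : ℝ) (z : ℂ) : ℂ :=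
  (Real.cos (gap ω α * t) : ℂ) * z +
    ((Real.sin (gap ω α * t) / gap ω α : ℝ) : ℂ) * (-(I * ω * z) + I * (starRingEnd ℂ) α)

/-- Second homogeneous coordinate of the Riccati flow; see `flowNum`. -/
def flowDen (ω : ℝ) (α : ℂ) (t : ℝ) (z : ℂ) : ℂ :=
  (Real.cos (gap ω α * t) : ℂ) +
    ((Real.sin (gap ω α * t) / gap ω α : ℝ) : ℂ) * (-(I * α * z) + I * ω)

/-- The flow of `z' = i (α z² - 2 ω z + ᾱ)` on the unit disk, by Möbius transformations. -/
def diskFlow (ω : ℝ) (α : ℂ) (t : ℝ) (z : ℂ) : ℂ := flowNum ω α t z / flowDen ω α t z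

section Flow

variable {ω : ℝ} {α : ℂ}

theorem gap_sq (h : ‖α‖ < ω) : gap ω α ^ 2 = ω ^ 2 - ‖α‖ ^ 2 :=
  Real.sq_sqrt (by nlinarith [norm_nonneg α])

theorem gap_pos (h : ‖α‖ < ω) : 0 < gap ω α :=
  Real.sqrt_pos.2 (by nlinarith [norm_nonneg α])

theorem ofReal_gap_sq (h : ‖α‖ < ω) :
    (gap ω α : ℂ) ^ 2 = ω ^ 2 - α * (starRingEnd ℂ) α := by
  rw [mul_conj, normSq_eq_norm_sq, ← ofReal_pow, gap_sq h]
  push_cast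
  rfl

theorem cos_sq_add_gap_sq_mul (h : ‖α‖ < ω) (t : ℝ) :
    (Real.cos (gap ω α * t) : ℂ) ^ 2 + (ω ^ 2 - α * (starRingEnd ℂ) α) *
      ((Real.sin (gap ω α * t) / gap ω α : ℝ) : ℂ) ^ 2 = 1 := by
  rw [← ofReal_gap_sq h]
  norm_cast
  rw [div_pow, mul_div_cancel₀ _ (pow_ne_zero 2 (gap_pos h).ne')]
  exact Real.cos_sq_add_sin_sq _

theorem diskFlow_zero (ω : ℝ) (α z : ℂ) : diskFlow ω α 0 z = z := by
  simp [diskFlow, flowNum, flowDen]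

theorem norm_flowDen_sq_sub (h : ‖α‖ < ω) (t : ℝ) (z : ℂ) :
    ‖flowDen ω α t z‖ ^ 2 - ‖flowNum ω α t z‖ ^ 2 = 1 - ‖z‖ ^ 2 := by
  have h1 := cos_sq_add_gap_sq_mul h t
  rw [← ofReal_inj]
  simp only [flowNum, flowDen, ofReal_sub, ofReal_pow, ← mul_conj', ofReal_one, map_add, map_mul,
    map_neg, conj_ofReal, conj_I, conj_conj]
  set C := (Real.cos (gap ω α * t) : ℂ)
  set S := ((Real.sin (gap ω α * t) / gap ω α : ℝ) : ℂ)
  linear_combination (1 - z * (starRingEnd ℂ) z) * h1 +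
    S ^ 2 * (ω ^ 2 - α * (starRingEnd ℂ) α) * (z * (starRingEnd ℂ) z - 1) * I_sq

theorem flowDen_ne_zero (h : ‖α‖ < ω) (t : ℝ) {z : ℂ} (hz : ‖z‖ < 1) : flowDen ω α t z ≠ 0 := by
  intro h0
  have := norm_flowDen_sq_sub h t z
  rw [h0, norm_zero] at this
  nlinarith [norm_nonneg z, sq_nonneg ‖flowNum ω α t z‖]

theorem norm_diskFlow_lt_one (h : ‖α‖ < ω) (t : ℝ) {z : ℂ} (hz : ‖z‖ < 1) :
    ‖diskFlow ω α t z‖ < 1 := by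
  have h1 := norm_flowDen_sq_sub h t z
  have h2 := norm_pos_iff.2 (flowDen_ne_zero h t hz)
  rw [diskFlow, norm_div, div_lt_one h2]
  nlinarith [norm_nonneg z, norm_nonneg (flowNum ω α t z)]

theorem hasDerivAt_cos_gap_mul (h : ‖α‖ < ω) (t : ℝ) :
    HasDerivAt (fun t : ℝ => (Real.cos (gap ω α * t) : ℂ))
      (-((ω ^ 2 - α * (starRingEnd ℂ) α) * ((Real.sin (gap ω α * t) / gap ω α : ℝ) : ℂ))) t := by
  have hΩ : (gap ω α : ℂ) ≠ 0 := ofReal_ne_zero.2 (gap_pos h).ne'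
  refine ((hasDerivAt_const_mul (gap ω α)).cos.ofReal_comp (z := t)).congr_deriv ?_
  rw [← ofReal_gap_sq h]
  push_cast
  field_simp

theorem hasDerivAt_sin_gap_mul_div (h : ‖α‖ < ω) (t : ℝ) :
    HasDerivAt (fun t : ℝ => ((Real.sin (gap ω α * t) / gap ω α : ℝ) : ℂ))
      (Real.cos (gap ω α * t) : ℂ) t := by
  have hΩ : (gap ω α : ℂ) ≠ 0 := ofReal_ne_zero.2 (gap_pos h).ne'
  refine (((hasDerivAt_const_mul (gap ω α)).sin.div_const
    (gap ω α)).ofReal_comp (z := t)).congr_deriv ?_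
  push_cast
  field_simp

theorem hasDerivAt_flowNum (h : ‖α‖ < ω) (t : ℝ) (z : ℂ) :
    HasDerivAt (fun t => flowNum ω α t z)
      (-(I * ω * flowNum ω α t z) + I * (starRingEnd ℂ) α * flowDen ω α t z) t := by
  refine (((hasDerivAt_cos_gap_mul h t).mul_const z).add
    ((hasDerivAt_sin_gap_mul_div h t).mul_const
      (-(I * ω * z) + I * (starRingEnd ℂ) α))).congr_deriv ?_
  rw [flowNum, flowDen]
  linear_combination -((Real.sin (gap ω α * t) / gap ω α : ℝ) : ℂ) *
    (ω ^ 2 - α * (starRingEnd ℂ) α) * z * I_sq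

theorem hasDerivAt_flowDen (h : ‖α‖ < ω) (t : ℝ) (z : ℂ) :
    HasDerivAt (fun t => flowDen ω α t z)
      (-(I * α * flowNum ω α t z) + I * ω * flowDen ω α t z) t := by
  refine ((hasDerivAt_cos_gap_mul h t).add
    ((hasDerivAt_sin_gap_mul_div h t).mul_const (-(I * α * z) + I * ω))).congr_deriv ?_
  rw [flowNum, flowDen]
  linear_combination -((Real.sin (gap ω α * t) / gap ω α : ℝ) : ℂ) *
    (ω ^ 2 - α * (starRingEnd ℂ) α) * I_sq

theorem hasDerivAt_diskFlow (h : ‖α‖ < ω) {z : ℂ} (hz : ‖z‖ < 1) (t : ℝ) :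
    HasDerivAt (fun t => diskFlow ω α t z)
      (I * (α * diskFlow ω α t z ^ 2 - 2 * ω * diskFlow ω α t z + (starRingEnd ℂ) α)) t := by
  have hd := flowDen_ne_zero h t hz
  refine ((hasDerivAt_flowNum h t z).div (hasDerivAt_flowDen h t z) hd).congr_deriv ?_
  rw [diskFlow]
  field_simp
  ring

theorem diskFlow_neg_diskFlow (h : ‖α‖ < ω) (t : ℝ) {z : ℂ} (hz : ‖z‖ < 1) :
    diskFlow ω α (-t) (diskFlow ω α t z) = z := by
  have hd := flowDen_ne_zero h t hz
  have hd' := flowDen_ne_zero h (-t) (norm_diskFlow_lt_one h t hz)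
  have h1 := cos_sq_add_gap_sq_mul h t
  rw [diskFlow, div_eq_iff hd', ← mul_left_inj' hd]
  have hw : diskFlow ω α t z * flowDen ω α t z = flowNum ω α t z := div_mul_cancel₀ _ hd
  have hden : flowDen ω α t z = (Real.cos (gap ω α * t) : ℂ) +
      ((Real.sin (gap ω α * t) / gap ω α : ℝ) : ℂ) * (-(I * α * z) + I * ω) := rfl
  have e1 : flowNum ω α (-t) (diskFlow ω α t z) * flowDen ω α t z = z := by
    simp only [flowNum, mul_neg, Real.cos_neg, Real.sin_neg, neg_div, ofReal_neg] at hw ⊢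
    set w := diskFlow ω α t z
    set C := (Real.cos (gap ω α * t) : ℂ)
    set S := ((Real.sin (gap ω α * t) / gap ω α : ℝ) : ℂ)
    linear_combination (C + S * I * ω) * hw - S * I * (starRingEnd ℂ) α * hden +
      z * h1 + S ^ 2 * (α * (starRingEnd ℂ) α - ω ^ 2) * z * I_sq
  have e2 : flowDen ω α (-t) (diskFlow ω α t z) * flowDen ω α t z = 1 := by
    rw [flowNum] at hw
    have hden' : flowDen ω α (-t) (diskFlow ω α t z) =
        (Real.cos (gap ω α * t) : ℂ) - ((Real.sin (gap ω α * t) / gap ω α : ℝ) : ℂ) *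
          (-(I * α * diskFlow ω α t z) + I * ω) := by
      simp only [flowDen, mul_neg, Real.cos_neg, Real.sin_neg, neg_div, ofReal_neg]
      ring
    rw [hden']
    set w := diskFlow ω α t z
    set C := (Real.cos (gap ω α * t) : ℂ)
    set S := ((Real.sin (gap ω α * t) / gap ω α : ℝ) : ℂ)
    linear_combination S * I * α * hw + (C - S * I * ω) * hden + h1 +
      S ^ 2 * (α * (starRingEnd ℂ) α - ω ^ 2) * I_sq
  rw [e1, mul_assoc, e2, mul_one]

theorem norm_flowDen_le (h : ‖α‖ < ω) (t : ℝ) (z : ℂ) :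
    ‖flowDen ω α t z‖ * gap ω α ≤ ‖α‖ * ‖z‖ + ω := by
  have hω : 0 < ω := (norm_nonneg α).trans_lt h
  have hΩ := gap_pos h
  have hΩ2 := gap_sq h
  set c := Real.cos (gap ω α * t) with hc
  set s := Real.sin (gap ω α * t) with hs
  have hcs : c ^ 2 + s ^ 2 = 1 := Real.cos_sq_add_sin_sq _
  have h1 : flowDen ω α t z * gap ω α =
      ((c * gap ω α : ℝ) + (s * ω : ℝ) * I) + -((s : ℂ) * I * α * z) := by
    have : (gap ω α : ℂ) ≠ 0 := ofReal_ne_zero.2 hΩ.ne'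
    rw [flowDen, ← hc, ← hs]
    push_cast
    field_simp
    ring
  have h2 : ‖((c * gap ω α : ℝ) + (s * ω : ℝ) * I : ℂ)‖ ≤ ω := by
    rw [norm_add_mul_I]
    refine Real.sqrt_le_iff.2 ⟨hω.le, ?_⟩
    nlinarith [sq_nonneg (c * ‖α‖)]
  have h3 : ‖-((s : ℂ) * I * α * z)‖ ≤ ‖α‖ * ‖z‖ := by
    rw [norm_neg, norm_mul, norm_mul, norm_mul, norm_I, mul_one, norm_real, mul_assoc]
    exact mul_le_of_le_one_left (by positivity) (Real.abs_sin_le_one _)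
  calc ‖flowDen ω α t z‖ * gap ω α = ‖flowDen ω α t z * gap ω α‖ := by
        rw [norm_mul, norm_real, Real.norm_of_nonneg hΩ.le]
    _ ≤ ω + ‖α‖ * ‖z‖ := by
        rw [h1]
        exact (norm_add_le _ _).trans (add_le_add h2 h3)
    _ = _ := add_comm _ _

/-- The flow moves the centre by at most the hyperbolic distance `artanh (‖α‖ / ω)`, and so it
increases the hyperbolic distance of a point from the centre by at most that amount. -/
theorem norm_diskFlow_mul_le (h : ‖α‖ < ω) (t : ℝ) {z : ℂ} (hz : ‖z‖ < 1) :
    ‖diskFlow ω α t z‖ * (‖α‖ * ‖z‖ + ω) ≤ ω * ‖z‖ + ‖α‖ := by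
  have hω : 0 < ω := (norm_nonneg α).trans_lt h
  have h1 := norm_flowDen_sq_sub h t z
  have h2 := norm_pos_iff.2 (flowDen_ne_zero h t hz)
  have h3 := norm_flowDen_le h t z
  have hΩ2 := gap_sq h
  rw [diskFlow, norm_div, div_mul_eq_mul_div, div_le_iff₀ h2]
  set N := ‖flowNum ω α t z‖
  set D := ‖flowDen ω α t z‖
  have h4 : (D * gap ω α) ^ 2 ≤ (‖α‖ * ‖z‖ + ω) ^ 2 :=
    pow_le_pow_left₀ (mul_nonneg h2.le (gap_pos h).le) h3 2
  have h5 : 0 ≤ 1 - ‖z‖ ^ 2 := by nlinarith [norm_nonneg z]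
  refine le_of_sq_le_sq ?_ (by positivity)
  have h6 := mul_le_mul_of_nonneg_left h4 h5
  rw [mul_pow, hΩ2] at h6
  have h7 : N ^ 2 = D ^ 2 - (1 - ‖z‖ ^ 2) := by linarith
  rw [mul_pow, mul_pow, h7]
  linarith

/-- The lower bound that corresponds to `norm_diskFlow_mul_le`, which is applied here to the
inverse flow. -/
theorem le_norm_diskFlow_mul (h : ‖α‖ < ω) (t : ℝ) {z : ℂ} (hz : ‖z‖ < 1) :
    ω * ‖z‖ - ‖α‖ ≤ ‖diskFlow ω α t z‖ * (ω - ‖α‖ * ‖z‖) := by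
  have h1 := norm_diskFlow_mul_le h (-t) (norm_diskFlow_lt_one h t hz)
  rw [diskFlow_neg_diskFlow h t hz] at h1
  linarith

theorem continuousOn_diskFlow (h : ‖α‖ < ω) :
    ContinuousOn (fun p : ℝ × ℂ => diskFlow ω α p.1 p.2) {p | ‖p.2‖ < 1} := by
  refine ContinuousOn.div ?_ ?_ fun p hp => flowDen_ne_zero h p.1 hp
  · unfold flowNum
    fun_prop
  · unfold flowDen
    fun_prop

/-- After a quarter of the period `2 π / gap` the flow is a hyperbolic half-turn. -/
theorem diskFlow_quarter (h : ‖α‖ < ω) (z : ℂ) :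
    diskFlow ω α (Real.pi / 2 / gap ω α) z =
      (-(ω * z) + (starRingEnd ℂ) α) / (-(α * z) + ω) := by
  have hΩ : (gap ω α : ℂ) ≠ 0 := ofReal_ne_zero.2 (gap_pos h).ne'
  rw [diskFlow, flowNum, flowDen, mul_div_cancel₀ _ (gap_pos h).ne', Real.cos_pi_div_two,
    Real.sin_pi_div_two, ofReal_zero, zero_mul, zero_add, zero_add,
    show -(I * ω * z) + I * (starRingEnd ℂ) α = I * (-(ω * z) + (starRingEnd ℂ) α) by ring,
    show -(I * α * z) + I * ω = I * (-(α * z) + ω) by ring, ← mul_assoc, ← mul_assoc]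
  refine mul_div_mul_left _ _ (mul_ne_zero ?_ I_ne_zero)
  rw [ofReal_div, ofReal_one]
  exact one_div_ne_zero hΩ

theorem exists_exp_mul_eq_norm (α : ℂ) :
    ∃ θ : ℝ, α * exp (θ * I) = ‖α‖ ∧ (starRingEnd ℂ) α = ‖α‖ * exp (θ * I) := by
  refine ⟨-arg α, ?_, ?_⟩
  · nth_rewrite 1 [← norm_mul_exp_arg_mul_I α]
    rw [mul_assoc, ← exp_add]
    simp
  · nth_rewrite 1 [← norm_mul_exp_arg_mul_I α]
    rw [map_mul, conj_ofReal, ← exp_conj]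
    simp

/-- The quarter-period image of the point `ρ e^{iθ}` on the diameter through the fixed point. -/
theorem norm_diskFlow_quarter (h : ‖α‖ < ω) {ρ : ℝ} (hρ : |ρ| < 1) {θ : ℝ}
    (h1 : α * exp (θ * I) = ‖α‖) (h2 : (starRingEnd ℂ) α = ‖α‖ * exp (θ * I)) :
    ‖diskFlow ω α (Real.pi / 2 / gap ω α) (ρ * exp (θ * I))‖ =
      |ω * ρ - ‖α‖| / (ω - ‖α‖ * ρ) := by
  have hpos : 0 < ω - ‖α‖ * ρ := by
    have := (abs_lt.1 hρ).2
    nlinarith [norm_nonneg α]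
  rw [diskFlow_quarter h, h2,
    show -(ω * (ρ * exp (θ * I))) + ‖α‖ * exp (θ * I) =
      ((-(ω * ρ - ‖α‖) : ℝ) : ℂ) * exp (θ * I) by push_cast; ring,
    show -(α * (ρ * exp (θ * I))) + ω = ((ω - ‖α‖ * ρ : ℝ) : ℂ) by
      push_cast; linear_combination -ρ * h1]
  rw [norm_div, norm_mul, norm_exp_ofReal_mul_I, norm_real, norm_real, mul_one, Real.norm_eq_abs,
    abs_neg, Real.norm_of_nonneg hpos.le]

/-- Every circle of radius at most `‖α‖ / ω` about the centre contains a point that the flow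
carries to the centre within a quarter of the period `2 π / gap`. -/
theorem exists_diskFlow_eq_zero (h : ‖α‖ < ω) {r : ℝ} (hr0 : 0 ≤ r) (hr : ω * r ≤ ‖α‖) :
    ∃ t ∈ Set.Icc 0 (Real.pi / 2 / gap ω α), ∃ z : ℂ, ‖z‖ = r ∧ diskFlow ω α t z = 0 := by
  have hω : 0 < ω := (norm_nonneg α).trans_lt h
  have hT : 0 ≤ Real.pi / 2 / gap ω α := div_nonneg (by positivity) (gap_pos h).le
  have hcont : ContinuousOn (fun t => ‖diskFlow ω α (-t) 0‖)
      (Set.Icc 0 (Real.pi / 2 / gap ω α)) := by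
    refine ((continuousOn_diskFlow h).comp (f := fun t : ℝ => (-t, (0 : ℂ))) (by fun_prop)
      fun t _ => ?_).norm
    simp
  have hend : ‖diskFlow ω α (-(Real.pi / 2 / gap ω α)) 0‖ = ‖α‖ / ω := by
    have hΩ := (gap_pos h).ne'
    simp only [diskFlow, flowNum, flowDen, mul_neg, mul_div_cancel₀ _ hΩ, Real.cos_neg,
      Real.sin_neg, Real.cos_pi_div_two, Real.sin_pi_div_two, mul_zero, neg_zero, zero_add,
      ofReal_zero, norm_div, norm_mul, norm_I, one_mul, RCLike.norm_conj, norm_real,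
      Real.norm_of_nonneg hω.le]
    refine mul_div_mul_left _ _ ?_
    simpa using hΩ
  obtain ⟨t, ht, htr⟩ := intermediate_value_Icc hT hcont
    (show r ∈ Set.Icc _ _ by
      simp only [neg_zero, diskFlow_zero, norm_zero, hend]
      exact ⟨hr0, (le_div_iff₀ hω).2 (by linarith)⟩)
  refine ⟨t, ht, diskFlow ω α (-t) 0, htr, ?_⟩
  have := diskFlow_neg_diskFlow h (-t) (z := 0) (by simp)
  rwa [neg_neg] at this

/-- One pulse carries the annulus `r ≤ ‖z‖ ≤ R` onto all radii which are not excluded by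
`norm_diskFlow_mul_le` and `le_norm_diskFlow_mul`. -/
theorem exists_norm_diskFlow_eq (h : ‖α‖ < ω) {r R s : ℝ} (hr : 0 ≤ r) (hrR : r ≤ R) (hR : R < 1)
    (hs : 0 ≤ s) (h1 : ω * r - ‖α‖ ≤ s * (ω - ‖α‖ * r)) (h2 : s * (‖α‖ * R + ω) ≤ ω * R + ‖α‖) :
    ∃ t : ℝ, 0 ≤ t ∧ ∃ z : ℂ, r ≤ ‖z‖ ∧ ‖z‖ ≤ R ∧ ‖diskFlow ω α t z‖ = s := by
  have hω : 0 < ω := (norm_nonneg α).trans_lt h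
  have hT : 0 ≤ Real.pi / 2 / gap ω α := div_nonneg (by positivity) (gap_pos h).le
  set T := Real.pi / 2 / gap ω α
  -- The annulus times the quarter period is connected, so it suffices to find one value of the
  -- radius on each side of `s`.
  let K : Set (ℝ × ℝ × ℝ) := Set.Icc 0 T ×ˢ Set.Icc r R ×ˢ Set.univ
  let f : ℝ × ℝ × ℝ → ℝ := fun p => ‖diskFlow ω α p.1 (p.2.1 * exp (p.2.2 * I))‖
  have hK : IsPreconnected K :=
    isPreconnected_Icc.prod (isPreconnected_Icc.prod isPreconnected_univ)
  have hnorm : ∀ p ∈ K, ‖(p.2.1 * exp (p.2.2 * I) : ℂ)‖ = p.2.1 := by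
    rintro ⟨t, ρ, θ⟩ ⟨-, ⟨hρ, -⟩, -⟩
    change ‖(ρ * exp (θ * I) : ℂ)‖ = ρ
    rw [norm_mul, norm_exp_ofReal_mul_I, mul_one, norm_real, Real.norm_of_nonneg (hr.trans hρ)]
  have hf : ContinuousOn f K := by
    refine ((continuousOn_diskFlow h).comp
      (f := fun p : ℝ × ℝ × ℝ => (p.1, (p.2.1 * exp (p.2.2 * I) : ℂ))) (by fun_prop)
      fun p hp => ?_).norm
    change ‖(p.2.1 * exp (p.2.2 * I) : ℂ)‖ < 1
    rw [hnorm p hp]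
    exact hp.2.1.2.trans_lt hR
  obtain ⟨θ, hθ1, hθ2⟩ := exists_exp_mul_eq_norm α
  have hlow : ∃ p ∈ K, f p ≤ s := by
    rcases le_or_gt (ω * r) ‖α‖ with hc | hc
    · obtain ⟨t, ht, z, hz, h0⟩ := exists_diskFlow_eq_zero h hr hc
      refine ⟨(t, r, arg z), ⟨ht, ⟨le_rfl, hrR⟩, trivial⟩, ?_⟩
      change ‖diskFlow ω α t (r * exp (arg z * I))‖ ≤ s
      rwa [← hz, norm_mul_exp_arg_mul_I, h0, norm_zero]
    · refine ⟨(T, r, θ), ⟨⟨hT, le_rfl⟩, ⟨le_rfl, hrR⟩, trivial⟩, ?_⟩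
      change ‖diskFlow ω α T (r * exp (θ * I))‖ ≤ s
      have hr1 : r < 1 := hrR.trans_lt hR
      rw [norm_diskFlow_quarter h (by rwa [abs_of_nonneg hr]) hθ1 hθ2,
        abs_of_pos (by linarith), div_le_iff₀ (by nlinarith [norm_nonneg α])]
      exact h1
  have hhigh : ∃ p ∈ K, s ≤ f p := by
    refine ⟨(T, R, θ + Real.pi), ⟨⟨hT, le_rfl⟩, ⟨hrR, le_rfl⟩, trivial⟩, ?_⟩
    change s ≤ ‖diskFlow ω α T (R * exp ((θ + Real.pi : ℝ) * I))‖
    have hR0 : 0 ≤ R := hr.trans hrR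
    have hneg : (R * exp ((θ + Real.pi : ℝ) * I) : ℂ) = (-R : ℝ) * exp (θ * I) := by
      rw [ofReal_add, add_mul, exp_add, exp_pi_mul_I]
      push_cast
      ring
    rw [hneg, norm_diskFlow_quarter h (by rwa [abs_neg, abs_of_nonneg hR0]) hθ1 hθ2,
      show ω * -R - ‖α‖ = -(ω * R + ‖α‖) by ring, abs_neg, abs_of_nonneg (by positivity),
      show ω - ‖α‖ * -R = ‖α‖ * R + ω by ring, le_div_iff₀ (by positivity)]
    exact h2
  obtain ⟨a, ha, has⟩ := hlow
  obtain ⟨b, hb, hbs⟩ := hhigh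
  obtain ⟨p, hp, hps⟩ := hK.intermediate_value ha hb hf ⟨has, hbs⟩
  refine ⟨p.1, hp.1.1, p.2.1 * exp (p.2.2 * I), ?_, ?_, hps⟩
  · rw [hnorm p hp]
    exact hp.2.1.1
  · rw [hnorm p hp]
    exact hp.2.1.2

end Flow

/-! ### The free rotation -/

section Rotation

variable {ω : ℝ}

theorem norm_diskFlow_zero (hω : 0 < ω) (t : ℝ) {z : ℂ} (hz : ‖z‖ < 1) :
    ‖diskFlow ω 0 t z‖ = ‖z‖ := by
  have h : ‖(0 : ℂ)‖ < ω := by simpa using hω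
  have h1 := norm_diskFlow_mul_le h t hz
  have h2 := le_norm_diskFlow_mul h t hz
  simp only [norm_zero, zero_mul, zero_add, add_zero, sub_zero] at h1 h2
  nlinarith

theorem diskFlow_zero_eq_rotation (hω : 0 < ω) (t : ℝ) (z : ℂ) :
    diskFlow ω 0 t z = exp ((-(2 * ω * t) : ℝ) * I) * z := by
  have hg : gap ω 0 = ω := by simp [gap, Real.sqrt_sq hω.le]
  have hω' : (ω : ℂ) ≠ 0 := ofReal_ne_zero.2 hω.ne'
  have hnum : flowNum ω 0 t z = exp (-(ω * t) * I) * z := by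
    rw [exp_mul_I, Complex.cos_neg, Complex.sin_neg, flowNum, hg, map_zero]
    push_cast
    field_simp
    ring
  have hden : flowDen ω 0 t z = exp (ω * t * I) := by
    rw [exp_mul_I, flowDen, hg]
    push_cast
    field_simp
    ring
  rw [diskFlow, hnum, hden, div_eq_iff (exp_ne_zero _), mul_right_comm, ← exp_add]
  push_cast
  ring_nf

theorem exists_diskFlow_zero_eq (hω : 0 < ω) {z w : ℂ} (h : ‖z‖ = ‖w‖) :
    ∃ t : ℝ, 0 ≤ t ∧ diskFlow ω 0 t z = w := by
  -- The rotation by `arg w - arg z` is reached after a nonnegative time, since `4 π` is added.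
  refine ⟨(4 * Real.pi - (arg w - arg z)) / (2 * ω), ?_, ?_⟩
  · have h1 := arg_le_pi w
    have h2 := neg_pi_lt_arg z
    have h3 := Real.pi_pos
    exact div_nonneg (by linarith) (by linarith)
  · rw [diskFlow_zero_eq_rotation hω, mul_div_cancel₀ _ (by positivity)]
    have h4 : ((-(4 * Real.pi - (arg w - arg z)) : ℝ) : ℂ) * I + arg z * I =
        arg w * I - (2 : ℕ) * (2 * Real.pi * I) := by
      push_cast
      ring
    have h5 := congrArg exp h4
    rw [exp_add, exp_sub, exp_nat_mul_two_pi_mul_I, div_one] at h5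
    calc _ = exp ((-(4 * Real.pi - (arg w - arg z)) : ℝ) * I) * (‖z‖ * exp (arg z * I)) := by
          rw [norm_mul_exp_arg_mul_I]
      _ = ‖w‖ * exp (arg w * I) := by rw [mul_left_comm, h5, h]
      _ = w := norm_mul_exp_arg_mul_I w

end Rotation

/-! ### Evolution of squeezed states -/

theorem exists_evolution_smul_squeezedVec [CompleteSpace ℋ] (e : HilbertBasis ℕ ℂ ℋ) {ω : ℝ}
    {α : ℂ} (h : ‖α‖ < ω) {H : ℋ →ₗ.[ℂ] ℋ} (hH : HasRealExpectation H)
    (hle : (hamiltonian e ω α).graph ≤ H.graph) {z : ℂ} (hz : ‖z‖ < 1) (t : ℝ) {s : ℂ}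
    (hs : s ≠ 0) :
    ∃ s' : ℂ, s' ≠ 0 ∧
      evolution H t (s • squeezedVec e z) = s' • squeezedVec e (diskFlow ω α t z) := by
  obtain ⟨c, hc, hc0, hsol⟩ := exists_squeezed_solution e ω α
    (fun t => norm_diskFlow_lt_one h t hz) (hasDerivAt_diskFlow h hz)
  have hsol' : IsSchrodingerSolution H
      fun t => s • c t • squeezedVec e (diskFlow ω α t z) := by
    intro t
    obtain ⟨v, hv, hv'⟩ := hsol t
    refine ⟨s • v, hv.const_smul s, hle ?_⟩
    rw [smul_comm]
    exact (hamiltonian e ω α).graph.smul_mem s hv'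
  have hev := hsol'.evolution_eq hH t
  simp only [hc0, one_smul, diskFlow_zero] at hev
  exact ⟨s * c t, mul_ne_zero hs (hc t), by rw [hev, smul_smul]⟩

/-- The points `z_n` of the unit disk with `[U_n ψ(z)] = [ψ(z_n)]`. -/
def diskPath (ω : ℝ) (α : ℂ) (Δt : ℕ → ℝ) (z : ℂ) : ℕ → ℂ
  | 0 => z
  | n + 1 => diskFlow ω (if Odd (n + 1) then 0 else α) (Δt (n + 1)) (diskPath ω α Δt z n)

theorem norm_ite_zero_lt {ω : ℝ} {α : ℂ} (h : ‖α‖ < ω) (p : Prop) [Decidable p] :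
    ‖if p then 0 else α‖ < ω := by
  split_ifs
  · simpa using (norm_nonneg α).trans_lt h
  · exact h

theorem norm_diskPath_lt_one {ω : ℝ} {α : ℂ} (h : ‖α‖ < ω) (Δt : ℕ → ℝ) {z : ℂ} (hz : ‖z‖ < 1)
    (n : ℕ) : ‖diskPath ω α Δt z n‖ < 1 := by
  induction n with
  | zero => exact hz
  | succ n ih => exact norm_diskFlow_lt_one (norm_ite_zero_lt h _) _ ih

theorem diskPath_congr (ω : ℝ) (α : ℂ) {Δt Δt' : ℕ → ℝ} (z : ℂ) {n : ℕ}
    (h : ∀ j ≤ n, Δt j = Δt' j) : diskPath ω α Δt z n = diskPath ω α Δt' z n := by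
  induction n with
  | zero => rfl
  | succ n ih =>
    rw [diskPath, diskPath, ih fun j hj => h j (hj.trans n.le_succ), h (n + 1) le_rfl]

theorem exists_pulseProduct_smul_squeezedVec [CompleteSpace ℋ] (e : HilbertBasis ℕ ℂ ℋ) {ω : ℝ}
    {α : ℂ} (h : ‖α‖ < ω) {z : ℂ} (hz : ‖z‖ < 1) (Δt : ℕ → ℝ) {s : ℂ} (hs : s ≠ 0) (n : ℕ) :
    ∃ s' : ℂ, s' ≠ 0 ∧
      pulseProduct (oscillator e ω) (hamiltonian e ω α) Δt n (s • squeezedVec e z) =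
        s' • squeezedVec e (diskPath ω α Δt z n) := by
  induction n with
  | zero => exact ⟨s, hs, rfl⟩
  | succ n ih =>
    obtain ⟨s₁, hs₁, h₁⟩ := ih
    rw [pulseProduct, Function.comp_apply, h₁, pulse, diskPath]
    have hz' := norm_diskPath_lt_one h Δt hz n
    split_ifs
    · exact exists_evolution_smul_squeezedVec e (by simpa using (norm_nonneg α).trans_lt h)
        (hasRealExpectation_oscillator e ω) (graph_hamiltonian_zero_le_oscillator e ω) hz' _ hs₁
    · exact exists_evolution_smul_squeezedVec e h (hasRealExpectation_hamiltonian e ω α) le_rfl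
        hz' _ hs₁

/-- The control problem in `ℋ` is equivalent to the control problem in the unit disk. -/
theorem reachable_iff_exists_diskPath_eq [CompleteSpace ℋ] (e : HilbertBasis ℕ ℂ ℋ) {ω : ℝ}
    {α : ℂ} (h : ‖α‖ < ω) {z₀ zf : ℂ} (hz₀ : ‖z₀‖ < 1) (hzf : ‖zf‖ < 1) (n : ℕ) :
    Reachable e (oscillator e ω) (hamiltonian e ω α) n z₀ zf ↔
      ∃ Δt : ℕ → ℝ, (∀ j, 0 ≤ Δt j) ∧ diskPath ω α Δt z₀ n = zf := by
  -- For every squeezed state `ψ₀` the vector `U_n ψ₀` spans the line of the endpoint of the path.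
  have key : ∀ (Δt : ℕ → ℝ) (ψ₀ : ℋ), IsSqueezedState e z₀ ψ₀ →
      Submodule.span ℂ {pulseProduct (oscillator e ω) (hamiltonian e ω α) Δt n ψ₀} =
        squeezedLine e (diskPath ω α Δt z₀ n) := by
    rintro Δt ψ₀ ⟨hnorm, hmem⟩
    rw [squeezedLine_eq_span e hz₀] at hmem
    obtain ⟨s, rfl⟩ := Submodule.mem_span_singleton.1 hmem
    have hs : s ≠ 0 := by
      rintro rfl
      simp at hnorm
    obtain ⟨s', hs', h'⟩ := exists_pulseProduct_smul_squeezedVec e h hz₀ Δt hs n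
    rw [h', squeezedLine_eq_span e (norm_diskPath_lt_one h Δt hz₀ n),
      Submodule.span_singleton_smul_eq hs'.isUnit]
  constructor
  · rintro ⟨Δt, hΔt, ψ₀, hψ₀, hline⟩
    rw [key Δt ψ₀ hψ₀] at hline
    exact ⟨Δt, hΔt, (eq_of_squeezedLine_eq e hzf (norm_diskPath_lt_one h Δt hz₀ n) hline).symm⟩
  · rintro ⟨Δt, hΔt, rfl⟩
    obtain ⟨ψ₀, hψ₀⟩ := exists_isSqueezedState e hz₀
    exact ⟨Δt, hΔt, ψ₀, hψ₀, (key Δt ψ₀ hψ₀).symm⟩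

/-! ### The reachable annuli -/

section Radii

variable {ω : ℝ} {α : ℂ}

/-- The hyperbolic double of `‖ξ‖` is `‖α‖ / ω`. -/
theorem two_mul_norm_fixedPoint_mul (h : ‖α‖ < ω) :
    2 * ‖fixedPoint ω α‖ * ω = ‖α‖ * (1 + ‖fixedPoint ω α‖ ^ 2) := by
  rcases eq_or_ne α 0 with rfl | hα
  · simp [fixedPoint]
  have hα' : ‖α‖ ≠ 0 := norm_ne_zero_iff.2 hα
  have hω : 0 < ω := (norm_nonneg α).trans_lt h
  have hle : gap ω α ≤ ω := by
    nlinarith [gap_sq h, gap_pos h, norm_nonneg α]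
  have hx : ‖fixedPoint ω α‖ = (ω - gap ω α) / ‖α‖ := by
    rw [fixedPoint, ← gap, norm_div, norm_real, Real.norm_of_nonneg (sub_nonneg.2 hle)]
  rw [hx]
  field_simp
  linear_combination -gap_sq h

theorem maxRadius_succ (h : ‖α‖ < ω) {ρ : ℝ} {k : ℕ}
    (h0 : 0 ≤ maxRadius ‖fixedPoint ω α‖ ρ k) :
    maxRadius ‖fixedPoint ω α‖ ρ (k + 1) =
      (ω * maxRadius ‖fixedPoint ω α‖ ρ k + ‖α‖) /
        (‖α‖ * maxRadius ‖fixedPoint ω α‖ ρ k + ω) := by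
  have hω : 0 < ω := (norm_nonneg α).trans_lt h
  have hx := two_mul_norm_fixedPoint_mul h
  rw [maxRadius, div_eq_div_iff (by positivity) (by positivity)]
  linear_combination (1 - maxRadius ‖fixedPoint ω α‖ ρ k ^ 2) * hx

theorem maxRadius_mem_Ico (h : ‖α‖ < ω) {ρ : ℝ} (hρ0 : 0 ≤ ρ) (hρ1 : ρ < 1) (k : ℕ) :
    0 ≤ maxRadius ‖fixedPoint ω α‖ ρ k ∧ maxRadius ‖fixedPoint ω α‖ ρ k < 1 := by
  have hω : 0 < ω := (norm_nonneg α).trans_lt h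
  induction k with
  | zero => exact ⟨hρ0, hρ1⟩
  | succ k ih =>
    obtain ⟨h0, h1⟩ := ih
    rw [maxRadius_succ h h0]
    refine ⟨by positivity, ?_⟩
    rw [div_lt_one (by positivity)]
    nlinarith

theorem maxRadius_le_succ (h : ‖α‖ < ω) {ρ : ℝ} (hρ0 : 0 ≤ ρ) (hρ1 : ρ < 1) (k : ℕ) :
    maxRadius ‖fixedPoint ω α‖ ρ k ≤ maxRadius ‖fixedPoint ω α‖ ρ (k + 1) := by
  have hω : 0 < ω := (norm_nonneg α).trans_lt h
  obtain ⟨h0, h1⟩ := maxRadius_mem_Ico h hρ0 hρ1 k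
  rw [maxRadius_succ h h0, le_div_iff₀ (by positivity)]
  nlinarith [mul_nonneg (norm_nonneg α) (by nlinarith : 0 ≤ 1 - maxRadius ‖fixedPoint ω α‖ ρ k ^ 2)]

theorem minRadius_succ (h : ‖α‖ < ω) {ρ : ℝ} {k : ℕ}
    (h1 : minRadius ‖fixedPoint ω α‖ ρ k < 1) :
    minRadius ‖fixedPoint ω α‖ ρ (k + 1) =
      if ‖α‖ < ω * minRadius ‖fixedPoint ω α‖ ρ k then
        (ω * minRadius ‖fixedPoint ω α‖ ρ k - ‖α‖) / (ω - ‖α‖ * minRadius ‖fixedPoint ω α‖ ρ k)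
      else 0 := by
  have hω : 0 < ω := (norm_nonneg α).trans_lt h
  have hx := two_mul_norm_fixedPoint_mul h
  have hy : 2 * ‖fixedPoint ω α‖ / (1 + ‖fixedPoint ω α‖ ^ 2) = ‖α‖ / ω := by
    rw [div_eq_div_iff (by positivity) hω.ne', hx]
  simp only [minRadius, hy, div_lt_iff₀' hω]
  set r := minRadius ‖fixedPoint ω α‖ ρ k
  set x := ‖fixedPoint ω α‖
  have hd : 0 < ω - ‖α‖ * r := by nlinarith [norm_nonneg α]
  -- Positivity of the denominator, from `2 x = (‖α‖ / ω) (1 + x²)`.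
  have hd' : 0 < -2 * x * r + (1 + x ^ 2) := by
    have : ω * (-2 * x * r + (1 + x ^ 2)) = (1 + x ^ 2) * (ω - ‖α‖ * r) := by
      linear_combination -r * hx
    exact pos_of_mul_pos_right (this ▸ mul_pos (by positivity) hd) hω.le
  congr 1
  rw [div_eq_div_iff hd'.ne' hd.ne']
  linear_combination (r ^ 2 - 1) * hx

theorem minRadius_mem_Icc (h : ‖α‖ < ω) {ρ : ℝ} (hρ0 : 0 ≤ ρ) (hρ1 : ρ < 1) (k : ℕ) :
    0 ≤ minRadius ‖fixedPoint ω α‖ ρ k ∧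
      minRadius ‖fixedPoint ω α‖ ρ k ≤ maxRadius ‖fixedPoint ω α‖ ρ k := by
  induction k with
  | zero => exact ⟨hρ0, le_rfl⟩
  | succ k ih =>
    obtain ⟨h0, hle⟩ := ih
    have hmax := maxRadius_mem_Ico h hρ0 hρ1 k
    have h1 := hle.trans_lt hmax.2
    have hle' := hle.trans (maxRadius_le_succ h hρ0 hρ1 k)
    rw [minRadius_succ h h1]
    split_ifs with hc
    · have hd : 0 < ω - ‖α‖ * minRadius ‖fixedPoint ω α‖ ρ k := by nlinarith [norm_nonneg α]
      refine ⟨div_nonneg (by linarith) hd.le, le_trans ?_ hle'⟩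
      rw [div_le_iff₀ hd]
      nlinarith [mul_nonneg (norm_nonneg α)
        (by nlinarith : 0 ≤ 1 - minRadius ‖fixedPoint ω α‖ ρ k ^ 2)]
    · exact ⟨le_rfl, h0.trans hle'⟩

theorem le_maxRadius_succ_iff (h : ‖α‖ < ω) {ρ : ℝ} (hρ0 : 0 ≤ ρ) (hρ1 : ρ < 1) (k : ℕ) (s : ℝ) :
    s ≤ maxRadius ‖fixedPoint ω α‖ ρ (k + 1) ↔
      s * (‖α‖ * maxRadius ‖fixedPoint ω α‖ ρ k + ω) ≤
        ω * maxRadius ‖fixedPoint ω α‖ ρ k + ‖α‖ := by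
  have hω : 0 < ω := (norm_nonneg α).trans_lt h
  have h0 := (maxRadius_mem_Ico h hρ0 hρ1 k).1
  rw [maxRadius_succ h h0, le_div_iff₀ (by positivity)]

theorem minRadius_succ_le_iff (h : ‖α‖ < ω) {ρ : ℝ} (hρ0 : 0 ≤ ρ) (hρ1 : ρ < 1) (k : ℕ) {s : ℝ}
    (hs : 0 ≤ s) :
    minRadius ‖fixedPoint ω α‖ ρ (k + 1) ≤ s ↔
      ω * minRadius ‖fixedPoint ω α‖ ρ k - ‖α‖ ≤
        s * (ω - ‖α‖ * minRadius ‖fixedPoint ω α‖ ρ k) := by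
  have h1 := (minRadius_mem_Icc h hρ0 hρ1 k).2.trans_lt (maxRadius_mem_Ico h hρ0 hρ1 k).2
  have hd : 0 < ω - ‖α‖ * minRadius ‖fixedPoint ω α‖ ρ k := by
    nlinarith [norm_nonneg α, (minRadius_mem_Icc h hρ0 hρ1 k).1]
  rw [minRadius_succ h h1]
  split_ifs with hc
  · rw [div_le_iff₀ hd]
  · exact iff_of_true hs (by nlinarith [mul_nonneg hs hd.le])

/-- The points reached in the unit disk after `2 k + 1` pulses form an annulus. -/
theorem exists_diskPath_eq_iff (h : ‖α‖ < ω) {z₀ : ℂ} (hz₀ : ‖z₀‖ < 1) (k : ℕ) {w : ℂ}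
    (hw : ‖w‖ < 1) :
    (∃ Δt : ℕ → ℝ, (∀ j, 0 ≤ Δt j) ∧ diskPath ω α Δt z₀ (2 * k + 1) = w) ↔
      minRadius ‖fixedPoint ω α‖ ‖z₀‖ k ≤ ‖w‖ ∧ ‖w‖ ≤ maxRadius ‖fixedPoint ω α‖ ‖z₀‖ k := by
  have hω : 0 < ω := (norm_nonneg α).trans_lt h
  have hodd : ∀ k, Odd (2 * k + 1) := fun k => ⟨k, rfl⟩
  have hone : ∀ Δt : ℕ → ℝ, ∀ k, diskPath ω α Δt z₀ (2 * k + 1) =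
      diskFlow ω 0 (Δt (2 * k + 1)) (diskPath ω α Δt z₀ (2 * k)) := fun Δt k => by
    rw [diskPath, if_pos (hodd k)]
  have hstep : ∀ Δt : ℕ → ℝ, ∀ k, diskPath ω α Δt z₀ (2 * k + 2) =
      diskFlow ω α (Δt (2 * k + 2)) (diskPath ω α Δt z₀ (2 * k + 1)) := fun Δt k => by
    rw [diskPath, if_neg (by rw [Nat.not_odd_iff_even]; exact ⟨k + 1, by ring⟩)]
  induction k generalizing w with
  | zero =>
    simp only [minRadius, maxRadius]
    constructor
    · rintro ⟨Δt, -, rfl⟩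
      have hn : ‖diskPath ω α Δt z₀ (2 * 0 + 1)‖ = ‖z₀‖ := by
        rw [hone]
        exact norm_diskFlow_zero hω _ hz₀
      exact ⟨hn.ge, hn.le⟩
    · rintro ⟨h1, h2⟩
      obtain ⟨t, ht, htw⟩ := exists_diskFlow_zero_eq hω (le_antisymm h1 h2)
      exact ⟨fun _ => t, fun _ => ht, by rw [hone]; exact htw⟩
  | succ k ih =>
    have hmin := minRadius_mem_Icc h (norm_nonneg z₀) hz₀ k
    have hmax := maxRadius_mem_Ico h (norm_nonneg z₀) hz₀ k
    rw [minRadius_succ_le_iff h (norm_nonneg z₀) hz₀ k (norm_nonneg w),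
      le_maxRadius_succ_iff h (norm_nonneg z₀) hz₀ k]
    constructor
    · rintro ⟨Δt, hΔt, rfl⟩
      have hz := norm_diskPath_lt_one h Δt hz₀ (2 * k + 1)
      obtain ⟨h1, h2⟩ := (ih hz).1 ⟨Δt, hΔt, rfl⟩
      have hz' := norm_diskPath_lt_one h Δt hz₀ (2 * k + 2)
      have hn : ‖diskPath ω α Δt z₀ (2 * (k + 1) + 1)‖ = ‖diskFlow ω α (Δt (2 * k + 2))
          (diskPath ω α Δt z₀ (2 * k + 1))‖ := by
        rw [← hstep, hone]
        exact norm_diskFlow_zero hω _ hz'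
      rw [hn]
      have h3 := norm_diskFlow_mul_le h (Δt (2 * k + 2)) hz
      have h4 := le_norm_diskFlow_mul h (Δt (2 * k + 2)) hz
      have h5 := norm_diskFlow_lt_one h (Δt (2 * k + 2)) hz
      set σ := ‖diskFlow ω α (Δt (2 * k + 2)) (diskPath ω α Δt z₀ (2 * k + 1))‖
      -- Both bounds are monotone in the radius, since `‖α‖ σ < ω`.
      have h6 : 0 ≤ ω - ‖α‖ * σ := by nlinarith [norm_nonneg α]
      have h7 : 0 ≤ ω + ‖α‖ * σ := by positivity
      constructor
      · linarith [mul_le_mul_of_nonneg_left h1 h7]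
      · linarith [mul_le_mul_of_nonneg_left h2 h6]
    · rintro ⟨h1, h2⟩
      obtain ⟨t, ht, z, hrz, hzR, hzs⟩ := exists_norm_diskFlow_eq h hmin.1 hmin.2 hmax.2
        (norm_nonneg w) h1 h2
      obtain ⟨Δt, hΔt, hpath⟩ := (ih (hzR.trans_lt hmax.2)).2 ⟨hrz, hzR⟩
      obtain ⟨t', ht', hrot⟩ := exists_diskFlow_zero_eq hω hzs
      refine ⟨fun j => if j ≤ 2 * k + 1 then Δt j else if j = 2 * k + 2 then t else t',
        fun j => ?_, ?_⟩
      · dsimp only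
        split_ifs
        exacts [hΔt j, ht, ht']
      · rw [hone, show 2 * (k + 1) = 2 * k + 2 by ring, hstep,
          diskPath_congr ω α (Δt' := Δt) z₀ fun j hj => if_pos hj, hpath]
        simpa using hrot

end Radii

end SqueezedStates

end

theorem theorem2 {ℋ : Type*} [NormedAddCommGroup ℋ] [InnerProductSpace ℂ ℋ] [CompleteSpace ℋ]
    (e : HilbertBasis ℕ ℂ ℋ) (ω : ℝ) (α : ℂ) (hstable : ‖α‖ < ω)
    (z₀ zf : ℂ) (hz₀ : ‖z₀‖ < 1) (hzf : ‖zf‖ < 1) (k : ℕ) :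
    SqueezedStates.Reachable e (SqueezedStates.oscillator e ω) (SqueezedStates.hamiltonian e ω α)
        (2 * k + 1) z₀ zf ↔
      SqueezedStates.minRadius ‖SqueezedStates.fixedPoint ω α‖ ‖z₀‖ k ≤ ‖zf‖ ∧
        ‖zf‖ ≤ SqueezedStates.maxRadius ‖SqueezedStates.fixedPoint ω α‖ ‖z₀‖ k :=
  (SqueezedStates.reachable_iff_exists_diskPath_eq e hstable hz₀ hzf (2 * k + 1)).trans
    (SqueezedStates.exists_diskPath_eq_iff hstable hz₀ k hzf)
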